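/- Let $\lambda_0>0$, $v>0$ and $h\in\mathbb R$. Drones fly in the plane $z=h$. Their initial positions form a homogeneous Poisson point process of density $\lambda_0$ in this plane; each drone moves along a straight line in this plane with the same speed $v$, in a direction uniform on $[0,2\pi)$, the directions being independent of each other and of the initial positions (same speed model). A user sits at the origin and is served, at every time, by the closest drone. Let $H(t)$ be the event that at some time $s\in[0,t)$ the serving drone differs from the serving drone at time $t$. Then $H(t)$ is an event up to null sets and, for every $t\ge 0$, $$\mathbb P[H(t)] = 1-\frac1{2\pi}\int_{vt}^\infty\!\!\int_0^{2\pi}2\pi\lambda_0u\,e^{-\lambda_0[\pi u^2+Q]}\,d\theta\,du-\frac1{2\pi}\int_0^{vt}\!\!\int_0^{2\pi}2\pi\lambda_0u\,e^{-\lambda_0[\pi u^2+\pi(vt-u)^2+Q]}\,d\theta\,du,$$ where $Q=\int_{|vt-u|}^{R(v,u,\theta)}2\pi u_x\,\frac1\pi\arccos\!\Big(\frac{u^2-u_x^2-v^2t^2}{2u_xvt}\Big)\,du_x$ and $R(w,u,\theta)=\sqrt{u^2+w^2t^2-2uwt\cos\theta}$. Moreover, for every $t>0$: (a) The following expression $B(V)$,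 which bounds the handover probability from below when the drone speeds are random with law $V$ on $[0,\infty)$, equals $\mathbb P[H(t)]$ for $V=\delta_v$: $$B(V)=1-\frac1{2\pi}\int\!\int_0^\infty\!\!\int_0^{2\pi}2\pi\lambda_0u\,e^{-\lambda_0\pi u^2}\exp\Big[-\int_0^{R(w,u,\theta)}2\pi u_x\,\lambda(t;u_x,u)\,du_x\Big]\,d\theta\,du\,V(dw),$$ $$\lambda(t;u_x,u)=\lambda_0\Big[1-V\big((-\infty,\tfrac{u-u_x}t]\big)-\int_{(\frac{|u-u_x|}t,\,\frac{u+u_x}t]}\frac1\pi\arccos\Big(\frac{w^2t^2+u_x^2-u^2}{2wtu_x}\Big)V(dw)\Big].$$ (b) The right-hand side of the formula for $\mathbb P[H(t)]$ above equals $$1-\frac1{2\pi}\int_0^\infty\!\!\int_0^{2\pi}2\pi\lambda_0r\exp\Big(-\lambda_0\big[r^2(\pi-\varphi_1+\tfrac12\sin2\varphi_1)+R^2(\pi-\varphi_2+\tfrac12\sin2\varphi_2)\big]\Big)\,d\theta\,dr,$$ with $R=R(v,r,\theta)$, $\varphi_1=\arccos\frac{v^2t^2+r^2-R^2}{2vtr}$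 and $\varphi_2=\arccos\frac{v^2t^2+R^2-r^2}{2vtR}$. -/

import Mathlib

open MeasureTheory ProbabilityTheory

noncomputable section

namespace DroneHandover

/-- The plane in which the drone base stations (DBSs) move, in planar coordinates centred at the
projection of the typical user. -/
abbrev Plane : Type := EuclideanSpace ℝ (Fin 2)

/-- Number of points of the family `x ω` (counted with their indices) that lie in `B`. -/
def count {Ω : Type*} (x : ℕ → Ω → Plane) (B : Set Plane) (ω : Ω) : ℕ∞ :=
  {i : ℕ | x i ω ∈ B}.encard

/-- The random points `x 0, x 1, …` (in an arbitrary enumeration) form a homogeneous Poisson point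
process of density `lam` in the plane: the number of points in a Borel set of finite area `a` is
Poisson with mean `lam * a`, and the numbers of points in pairwise disjoint Borel sets are
independent. -/
structure IsHomogeneousPPP {Ω : Type*} [MeasurableSpace Ω] (P : Measure Ω) (lam : ℝ)
    (x : ℕ → Ω → Plane) : Prop where
  measurable : ∀ i, Measurable (x i)
  poisson : ∀ B : Set Plane, MeasurableSet B → volume B ≠ ⊤ → ∀ k : ℕ,
    P {ω | count x B ω = k} =
      ENNReal.ofReal (Real.exp (-(lam * volume.real B)) * (lam * volume.real B) ^ k /
        (k.factorial : ℝ))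
  indep : ∀ (n : ℕ) (B : Fin n → Set Plane), (∀ j, MeasurableSet (B j)) →
    (Pairwise fun j k => Disjoint (B j) (B k)) →
    iIndepFun (fun (j : Fin n) (ω : Ω) => count x (B j) ω) P

/-- Initial data of the mobile network: the initial planar positions `x i` form a homogeneous
Poisson point process of density `lam`; the directions of motion `Θ i` are independent, uniform on
`[0, 2π)`, and independent of the initial positions. -/
structure IsMobileNetwork {Ω : Type*} [MeasurableSpace Ω] (P : Measure Ω) (lam : ℝ)
    (x : ℕ → Ω → Plane) (Θ : ℕ → Ω → ℝ) : Prop where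
  ppp : IsHomogeneousPPP P lam x
  measurable_dir : ∀ i, Measurable (Θ i)
  uniform_dir : ∀ i, pdf.IsUniform (Θ i) (Set.Ico 0 (2 * Real.pi)) P volume
  indep_dir : iIndepFun Θ P
  indep_pos_dir : IndepFun (fun ω i => x i ω) (fun ω i => Θ i ω) P

/-- Location in space, at time `s`, of a DBS flying at height `h` that starts above the planar point
`y` and moves on a straight line in direction `θ` with speed `v`. -/
def location (h v : ℝ) (y : Plane) (θ s : ℝ) : EuclideanSpace ℝ (Fin 3) :=
  !₂[y 0 + v * s * Real.cos θ, y 1 + v * s * Real.sin θ, h]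

/-- Indices of the DBSs that are closest at time `s` to the typical user, located at the origin,
when all DBSs have the same speed `v`. -/
def servingSet {Ω : Type*} (h v : ℝ) (x : ℕ → Ω → Plane) (Θ : ℕ → Ω → ℝ) (s : ℝ) (ω : Ω) :
    Set ℕ :=
  {i | ∀ j, ‖location h v (x i ω) (Θ i ω) s‖ ≤ ‖location h v (x j ω) (Θ j ω) s‖}

/-- The handover event `H(t)` in the same speed model: at some earlier time `0 ≤ s < t` the serving
DBS is not the one that serves at time `t`. -/
def handover {Ω : Type*} (h v : ℝ) (x : ℕ → Ω → Plane) (Θ : ℕ → Ω → ℝ) (t : ℝ) : Set Ω :=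
  {ω | ∃ s, 0 ≤ s ∧ s < t ∧ servingSet h v x Θ s ω ≠ servingSet h v x Θ t ω}

/-- `R = √(u² + v²t² - 2uvt cos θ)`. -/
def finalDist (v t u θ : ℝ) : ℝ :=
  Real.sqrt (u ^ 2 + v ^ 2 * t ^ 2 - 2 * u * v * t * Real.cos θ)

/-- The term `Q`, for serving distance `u` and angle `θ`. -/
def Q (v t u θ : ℝ) : ℝ :=
  ∫ ux in |v * t - u|..finalDist v t u θ,
    2 * Real.pi * ux * (1 / Real.pi) *
      Real.arccos ((u ^ 2 - ux ^ 2 - v ^ 2 * t ^ 2) / (2 * ux * (v * t)))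

/-- The explicit formula for the handover probability in the same speed model, with the integral
over the serving distance `u` split at `vt`. -/
def ssmFormula (lam v t : ℝ) : ℝ :=
  1 - 1 / (2 * Real.pi) *
      (∫ u in Set.Ioi (v * t), ∫ θ in (0 : ℝ)..(2 * Real.pi),
        2 * Real.pi * lam * u * Real.exp (-lam * (Real.pi * u ^ 2 + Q v t u θ)))
    - 1 / (2 * Real.pi) *
      (∫ u in (0 : ℝ)..(v * t), ∫ θ in (0 : ℝ)..(2 * Real.pi),
        2 * Real.pi * lam * u *
          Real.exp (-lam * (Real.pi * u ^ 2 + Real.pi * (v * t - u) ^ 2 + Q v t u θ)))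

/-- The expression for the handover probability of a user that moves with speed `v` on a straight
line in a network of static base stations. -/
def terrestrialFormula (lam v t : ℝ) : ℝ :=
  1 - 1 / (2 * Real.pi) *
    (∫ r in Set.Ioi (0 : ℝ), ∫ θ in (0 : ℝ)..(2 * Real.pi),
      let R := finalDist v t r θ
      let φ₁ := Real.arccos ((v ^ 2 * t ^ 2 + r ^ 2 - R ^ 2) / (2 * v * t * r))
      let φ₂ := Real.arccos ((v ^ 2 * t ^ 2 + R ^ 2 - r ^ 2) / (2 * v * t * R))
      2 * Real.pi * lam * r * Real.exp (-lam *
        (r ^ 2 * (Real.pi - φ₁ + 1 / 2 * Real.sin (2 * φ₁)) +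
          R ^ 2 * (Real.pi - φ₂ + 1 / 2 * Real.sin (2 * φ₂)))))

/-- Density at time `t` of the non-serving DBSs at distance `ux`, given that the serving DBS starts
at distance `u`, when the speeds of the DBSs have law `V`. The range of the second integral is
half-open so that the speed `(u - ux) / t`, which the cumulative distribution function already
includes, is not counted twice when it is an atom of `V`. -/
def nonServingDensity (lam : ℝ) (V : Measure ℝ) (t ux u : ℝ) : ℝ :=
  lam * (1 - V.real (Set.Iic ((u - ux) / t)) -
    ∫ w in Set.Ioc (|u - ux| / t) ((u + ux) / t),
      1 / Real.pi * Real.arccos ((w ^ 2 * t ^ 2 + ux ^ 2 - u ^ 2) / (2 * w * t * ux)) ∂V)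

/-- The lower bound on the handover probability in the different speed model with speed law `V`. -/
def dsmLowerBound (lam : ℝ) (V : Measure ℝ) (t : ℝ) : ℝ :=
  1 - 1 / (2 * Real.pi) *
    (∫ w, (∫ u in Set.Ioi (0 : ℝ), ∫ θ in (0 : ℝ)..(2 * Real.pi),
      2 * Real.pi * lam * u * Real.exp (-lam * Real.pi * u ^ 2) *
        Real.exp (-∫ ux in (0 : ℝ)..finalDist w t u θ,
          2 * Real.pi * ux * nonServingDensity lam V t ux u)) ∂V)

end DroneHandover

end

namespace DroneHandover

open Filter Topology

section PoissonProcess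

variable {Ω : Type*} [MeasurableSpace Ω] {P : Measure Ω} {lam : ℝ} {x : ℕ → Ω → Plane}

lemma measurable_count (hx : ∀ i, Measurable (x i)) {B : Set Plane} (hB : MeasurableSet B) :
    Measurable (count x B) := by
  refine measurable_encard.comp (measurable_set_iff.2 fun i => ?_)
  exact measurableSet_setOfPred.1 (hx i hB)

lemma IsHomogeneousPPP.ae_finite [IsProbabilityMeasure P] (hx : IsHomogeneousPPP P lam x)
    (hlam : 0 ≤ lam) {B : Set Plane} (hB : MeasurableSet B) (hB' : volume B ≠ ⊤) :
    ∀ᵐ ω ∂P, {i | x i ω ∈ B}.Finite := by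
  have hr : 0 ≤ lam * volume.real B := mul_nonneg hlam measureReal_nonneg
  have hmeas : ∀ k : ℕ, MeasurableSet {ω | count x B ω = k} := fun k =>
    measurable_count hx.measurable hB (MeasurableSet.singleton _)
  have h1 : P (⋃ k : ℕ, {ω | count x B ω = k}) = 1 := by
    rw [measure_iUnion _ hmeas]
    · simp_rw [hx.poisson B hB hB']
      have hs := hasSum_one_poissonMeasure (lam * volume.real B).toNNReal
      simp only [Real.coe_toNNReal _ hr] at hs
      rw [← ENNReal.ofReal_tsum_of_nonneg (fun k => by positivity) hs.summable, hs.tsum_eq,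
        ENNReal.ofReal_one]
    · intro j k hjk
      refine Set.disjoint_left.2 fun ω (h : _ = _) (h' : _ = _) => hjk ?_
      exact_mod_cast h.symm.trans h'
  have h2 : ∀ᵐ ω ∂P, ω ∈ ⋃ k : ℕ, {ω | count x B ω = k} :=
    (prob_compl_eq_zero_iff (MeasurableSet.iUnion hmeas)).2 h1
  filter_upwards [h2] with ω hω
  obtain ⟨k, hk⟩ := Set.mem_iUnion.1 hω
  exact Set.finite_of_encard_eq_coe hk

lemma IsHomogeneousPPP.map_count [IsProbabilityMeasure P] (hx : IsHomogeneousPPP P lam x)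
    (hlam : 0 ≤ lam) {B : Set Plane} (hB : MeasurableSet B) (hB' : volume B ≠ ⊤) :
    P.map (fun ω => (count x B ω).toNat) =
      poissonMeasure (lam * volume.real B).toNNReal := by
  have hr : 0 ≤ lam * volume.real B := mul_nonneg hlam measureReal_nonneg
  have hm : Measurable (fun ω => (count x B ω).toNat) :=
    Measurable.of_discrete.comp (measurable_count hx.measurable hB)
  refine Measure.ext_of_singleton fun k => ?_
  rw [Measure.map_apply hm (MeasurableSet.singleton _), poissonMeasure_singleton,
    Real.coe_toNNReal _ hr, ← hx.poisson B hB hB' k]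
  refine measure_congr ?_
  filter_upwards [hx.ae_finite hlam hB hB'] with ω hω
  have : count x B ω ≠ ⊤ := by simpa [count] using hω
  refine propext ?_
  change (count x B ω).toNat = k ↔ count x B ω = k
  rw [← ENat.natCast_toNat this]
  simp

lemma IsHomogeneousPPP.integral_pow_count [IsProbabilityMeasure P] (hx : IsHomogeneousPPP P lam x)
    (hlam : 0 ≤ lam) {B : Set Plane} (hB : MeasurableSet B) (hB' : volume B ≠ ⊤) (c : ℝ) :
    ∫ ω, c ^ (count x B ω).toNat ∂P = Real.exp (-lam * (volume.real B * (1 - c))) := by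
  have hm : Measurable (fun ω => (count x B ω).toNat) :=
    Measurable.of_discrete.comp (measurable_count hx.measurable hB)
  rw [← integral_map (f := fun k : ℕ => c ^ k) hm.aemeasurable
    Measurable.of_discrete.aestronglyMeasurable, hx.map_count hlam hB hB', integral_poissonMeasure]
  simp only [Real.coe_toNNReal _ (mul_nonneg hlam measureReal_nonneg), smul_eq_mul]
  have h := (NormedSpace.expSeries_div_hasSum_exp (lam * volume.real B * c)).mul_left
    (Real.exp (-(lam * volume.real B)))
  rw [← Real.exp_eq_exp_ℝ, ← Real.exp_add] at h
  rw [show -lam * (volume.real B * (1 - c)) =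
    -(lam * volume.real B) + lam * volume.real B * c by ring, ← h.tsum_eq]
  refine tsum_congr fun n => ?_
  rw [mul_pow (lam * volume.real B)]
  ring

lemma IsHomogeneousPPP.prob_two_le_count [IsProbabilityMeasure P] (hx : IsHomogeneousPPP P lam x)
    (hlam : 0 ≤ lam) {B : Set Plane} (hB : MeasurableSet B) (hB' : volume B ≠ ⊤) :
    P {ω | 2 ≤ count x B ω} ≤ ENNReal.ofReal ((lam * volume.real B) ^ 2) := by
  set r := lam * volume.real B with hrdef
  have hr : 0 ≤ r := mul_nonneg hlam measureReal_nonneg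
  have hm := measurable_count hx.measurable hB
  have hm' : ∀ k : ℕ∞, MeasurableSet {ω | count x B ω = k} := fun k =>
    hm (MeasurableSet.singleton k)
  have h0 := hx.poisson B hB hB' 0
  have h1 := hx.poisson B hB hB' 1
  rw [← hrdef] at h0 h1
  simp only [pow_zero, pow_one, Nat.factorial_zero, Nat.factorial_one, Nat.cast_one, div_one,
    mul_one, Nat.cast_zero] at h0 h1
  have hu : P ({ω | count x B ω = 0} ∪ {ω | count x B ω = 1}) =
      ENNReal.ofReal (Real.exp (-r) * (1 + r)) := by
    rw [measure_union _ (hm' 1), h0, h1,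
      ← ENNReal.ofReal_add (by positivity) (by positivity)]
    · ring_nf
    · exact Set.disjoint_left.2 fun ω (h : _ = _) (h' : _ = _) => by simp [h] at h'
  have hc : {ω | 2 ≤ count x B ω} = ({ω | count x B ω = 0} ∪ {ω | count x B ω = 1})ᶜ := by
    ext ω
    simp only [Set.mem_ofPred_eq, Set.mem_compl_iff, Set.mem_union]
    generalize count x B ω = k
    induction k using ENat.recTopCoe with
    | top => simp
    | coe k =>
      norm_cast
      omega
  rw [hc, prob_compl_eq_one_sub ((hm' 0).union (hm' 1)), hu, ← ENNReal.ofReal_one,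
    ← ENNReal.ofReal_sub _ (by positivity)]
  refine ENNReal.ofReal_le_ofReal ?_
  have := Real.add_one_le_exp (-r)
  nlinarith

/-- The probability generating functional at a function that takes finitely many values. -/
lemma IsHomogeneousPPP.integral_prod_pow_count [IsProbabilityMeasure P]
    (hx : IsHomogeneousPPP P lam x) (hlam : 0 ≤ lam) {n : ℕ} {B : Fin n → Set Plane}
    (hB : ∀ j, MeasurableSet (B j)) (hB' : ∀ j, volume (B j) ≠ ⊤)
    (hd : Pairwise fun j k => Disjoint (B j) (B k)) (c : Fin n → ℝ) :
    ∫ ω, ∏ j, c j ^ (count x (B j) ω).toNat ∂P =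
      Real.exp (-lam * ∑ j, volume.real (B j) * (1 - c j)) := by
  rw [(hx.indep n B hB hd).integral_fun_prod_comp (f := fun j (k : ℕ∞) => c j ^ k.toNat)
    (fun j => (measurable_count hx.measurable (hB j)).aemeasurable)
    (fun j => Measurable.of_discrete.aestronglyMeasurable), Finset.mul_sum, Real.exp_sum]
  exact Finset.prod_congr rfl fun j _ => hx.integral_pow_count hlam (hB j) (hB' j) _

end PoissonProcess

section Quantize

/-- Largest multiple of `1 / n` below `a`. -/
noncomputable def quantize (n : ℕ) (a : ℝ) : ℝ := (⌊n * a⌋₊ : ℝ) / n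

lemma quantize_nonneg (n : ℕ) (a : ℝ) : 0 ≤ quantize n a := by
  unfold quantize; positivity

lemma quantize_le {n : ℕ} {a : ℝ} (ha : 0 ≤ a) : quantize n a ≤ a := by
  rcases n.eq_zero_or_pos with rfl | hn
  · simpa [quantize] using ha
  · have hn' : (0 : ℝ) < n := by exact_mod_cast hn
    rw [quantize, div_le_iff₀ hn', mul_comm]
    exact Nat.floor_le (by positivity)

lemma quantize_zero (n : ℕ) : quantize n 0 = 0 := by simp [quantize]

lemma measurable_quantize (n : ℕ) : Measurable (quantize n) := by
  unfold quantize
  exact (Measurable.of_discrete.comp (Nat.measurable_floor.comp (measurable_const_mul _))).div_const _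

lemma tendsto_quantize {a : ℝ} (ha : 0 ≤ a) :
    Tendsto (fun n => quantize n a) atTop (𝓝 a) := by
  have := (tendsto_nat_floor_mul_div_atTop (R := ℝ) ha).comp tendsto_natCast_atTop_atTop
  refine this.congr fun n => ?_
  simp [quantize, mul_comm]

/-- The level sets of `quantize n ∘ q` at positive levels. -/
def quantizeLevel {α : Type*} (n : ℕ) (q : α → ℝ) (j : Fin n) : Set α :=
  {y | ⌊n * q y⌋₊ = j + 1}

@[to_additive]
lemma prod_quantizeLevel {α : Type*} {n : ℕ} {q : α → ℝ} (hq : ∀ y, q y ≤ 1) (y : α)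
    {M : Type*} [CommMonoid M] (F : ℝ → M) (hF : F 0 = 1) :
    F (quantize n (q y)) =
      ∏ j : Fin n, (quantizeLevel n q j).mulIndicator (fun _ => F ((j + 1 : ℝ) / n)) y := by
  classical
  simp only [Set.mulIndicator_apply, quantizeLevel, Set.mem_ofPred_eq]
  rcases Nat.eq_zero_or_pos ⌊n * q y⌋₊ with h0 | hpos
  · rw [Finset.prod_eq_one fun j _ => by rw [if_neg (by omega)]]
    simp [quantize, h0, hF]
  · have hle : ⌊n * q y⌋₊ ≤ n := by
      refine Nat.floor_le_of_le ?_
      exact mul_le_of_le_one_right (by positivity) (hq y)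
    rw [Finset.prod_eq_single_of_mem ⟨⌊n * q y⌋₊ - 1, by omega⟩ (Finset.mem_univ _)]
    · rw [if_pos (by simp; omega)]
      have : ((⌊n * q y⌋₊ - 1 : ℕ) : ℝ) + 1 = ⌊n * q y⌋₊ := by
        rw [Nat.cast_sub hpos]; simp
      simp only [quantize, this]
    · intro j _ hj
      rw [if_neg]
      intro h
      exact hj (Fin.ext (by simp; omega))

end Quantize

section GeneratingFunctional

variable {Ω : Type*} [MeasurableSpace Ω] {P : Measure Ω} {lam : ℝ} {x : ℕ → Ω → Plane}

omit [MeasurableSpace Ω] in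
lemma finprod_one_sub_quantize {n : ℕ} {q : Plane → ℝ} {B : Set Plane}
    (hq1 : ∀ y, q y ≤ 1) (hqB : ∀ y, y ∉ B → q y = 0) {ω : Ω} (hω : {i | x i ω ∈ B}.Finite) :
    ∏ᶠ i, (1 - quantize n (q (x i ω))) =
      ∏ j : Fin n, (1 - (j + 1 : ℝ) / n) ^ (count x (quantizeLevel n q j) ω).toNat := by
  classical
  rw [finprod_eq_prod_of_mulSupport_subset (s := hω.toFinset)]
  · simp_rw [prod_quantizeLevel hq1 _ (fun a => 1 - a) (sub_zero 1)]
    rw [Finset.prod_comm]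
    refine Finset.prod_congr rfl fun j _ => ?_
    simp only [Set.mulIndicator_apply]
    rw [Finset.prod_ite, Finset.prod_const_one, mul_one, Finset.prod_const]
    congr 1
    have : {i | x i ω ∈ quantizeLevel n q j} =
        ((hω.toFinset.filter fun i => x i ω ∈ quantizeLevel n q j : Finset ℕ) : Set ℕ) := by
      ext i
      simp only [Finset.coe_filter, Set.Finite.mem_toFinset, Set.mem_ofPred_eq]
      refine ⟨fun h => ⟨?_, h⟩, fun h => h.2⟩
      by_contra hi
      have h' : ⌊n * q (x i ω)⌋₊ = j + 1 := h
      rw [hqB _ hi] at h'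
      simp at h'
    rw [count, this, Set.encard_coe_eq_coe_finsetCard, ENat.toNat_natCast]
  · intro i hi
    by_contra h
    refine hi ?_
    have : x i ω ∉ B := by simpa using h
    simp [hqB _ this, quantize_zero]

lemma integral_quantize {n : ℕ} {q : Plane → ℝ} {B : Set Plane} (hqm : Measurable q)
    (hB' : volume B ≠ ⊤) (hq1 : ∀ y, q y ≤ 1) (hqB : ∀ y, y ∉ B → q y = 0) :
    (∀ j : Fin n, MeasurableSet (quantizeLevel n q j)) ∧
    (∀ j : Fin n, volume (quantizeLevel n q j) ≠ ⊤) ∧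
    ∫ y, quantize n (q y) = ∑ j : Fin n, volume.real (quantizeLevel n q j) * ((j + 1 : ℝ) / n) := by
  have hm : ∀ j : Fin n, MeasurableSet (quantizeLevel n q j) := fun j =>
    (Nat.measurable_floor.comp (hqm.const_mul _)) (MeasurableSet.singleton ((j : ℕ) + 1))
  have hf : ∀ j : Fin n, volume (quantizeLevel n q j) ≠ ⊤ := by
    refine fun j => measure_ne_top_of_subset (fun y hy => ?_) hB'
    by_contra h
    have h' : ⌊n * q y⌋₊ = j + 1 := hy
    rw [hqB _ h] at h'
    simp at h'
  refine ⟨hm, hf, ?_⟩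
  simp_rw [sum_quantizeLevel hq1 _ (fun a : ℝ => a) rfl]
  rw [integral_finsetSum]
  · refine Finset.sum_congr rfl fun j _ => ?_
    rw [integral_indicator_const _ (hm j), smul_eq_mul]
  · intro j _
    exact (integrable_indicator_iff (hm j)).2 (integrableOn_const (hf j))

lemma aestronglyMeasurable_finprod {w : Plane → ℝ} (hx : ∀ i, Measurable (x i)) (hw : Measurable w)
    (hfin : ∀ᵐ ω ∂P, {i | w (x i ω) ≠ 1}.Finite) :
    AEStronglyMeasurable (fun ω => ∏ᶠ i, w (x i ω)) P := by
  refine aestronglyMeasurable_of_tendsto_ae (u := atTop)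
    (f := fun (m : ℕ) ω => ∏ i ∈ Finset.range m, w (x i ω)) (fun m => ?_) ?_
  · exact (Finset.measurable_prod _ fun i _ => hw.comp (hx i)).aestronglyMeasurable
  · filter_upwards [hfin] with ω hω
    obtain ⟨N, hN⟩ := hω.bddAbove
    refine tendsto_const_nhds.congr' ?_
    filter_upwards [eventually_gt_atTop N] with m hm
    refine finprod_eq_prod_of_mulSupport_subset _ fun i hi => ?_
    simpa using (hN hi).trans_lt hm

lemma finprod_mem_unit {w : ℕ → ℝ} (hw : ∀ i, w i ∈ Set.Icc (0 : ℝ) 1) :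
    (∏ᶠ i, w i) ∈ Set.Icc (0 : ℝ) 1 :=
  finprod_induction (· ∈ Set.Icc (0 : ℝ) 1) (by simp)
    (fun _ _ ha hb => ⟨mul_nonneg ha.1 hb.1, mul_le_one₀ ha.2 hb.1 hb.2⟩) hw

/-- The probability generating functional of a homogeneous Poisson point process. -/
theorem IsHomogeneousPPP.generatingFunctional [IsProbabilityMeasure P]
    (hx : IsHomogeneousPPP P lam x) (hlam : 0 ≤ lam) {q : Plane → ℝ} (hqm : Measurable q)
    (hq0 : ∀ y, 0 ≤ q y) (hq1 : ∀ y, q y ≤ 1) {B : Set Plane} (hB : MeasurableSet B)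
    (hB' : volume B ≠ ⊤) (hqB : ∀ y, y ∉ B → q y = 0) :
    ∫ ω, ∏ᶠ i, (1 - q (x i ω)) ∂P = Real.exp (-lam * ∫ y, q y) := by
  have hfin := hx.ae_finite hlam hB hB'
  have hqn0 : ∀ n y, y ∉ B → quantize n (q y) = 0 := fun n y hy => by
    rw [hqB y hy, quantize_zero]
  have hunit : ∀ n y, 1 - quantize n (q y) ∈ Set.Icc (0 : ℝ) 1 := fun n y =>
    ⟨sub_nonneg.2 ((quantize_le (hq0 y)).trans (hq1 y)), sub_le_self _ (quantize_nonneg _ _)⟩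
  have hstep : ∀ n, ∫ ω, ∏ᶠ i, (1 - quantize n (q (x i ω))) ∂P =
      Real.exp (-lam * ∫ y, quantize n (q y)) := by
    intro n
    obtain ⟨hm, hf, hint⟩ := integral_quantize (n := n) hqm hB' hq1 hqB
    rw [hint, integral_congr_ae (hfin.mono fun ω hω => finprod_one_sub_quantize hq1 hqB hω),
      hx.integral_prod_pow_count hlam hm hf]
    · simp
    · refine fun j k hjk => Set.disjoint_left.2 fun y hj hk => hjk (Fin.ext ?_)
      have hj' : ⌊n * q y⌋₊ = j + 1 := hj
      have hk' : ⌊n * q y⌋₊ = k + 1 := hk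
      omega
  have hL : Tendsto (fun n => ∫ ω, ∏ᶠ i, (1 - quantize n (q (x i ω))) ∂P) atTop
      (𝓝 (∫ ω, ∏ᶠ i, (1 - q (x i ω)) ∂P)) := by
    refine tendsto_integral_of_dominated_convergence (fun _ => 1) (fun n => ?_)
      (integrable_const _) (fun n => .of_forall fun ω => ?_) ?_
    · refine aestronglyMeasurable_finprod (w := fun y => 1 - quantize n (q y)) hx.measurable
        (((measurable_quantize n).comp hqm).const_sub 1) ?_
      filter_upwards [hfin] with ω hω
      refine hω.subset fun i hi => ?_
      by_contra h
      exact hi (by rw [hqn0 n _ h, sub_zero])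
    · have := finprod_mem_unit (fun i => hunit n (x i ω))
      rw [Real.norm_of_nonneg this.1]
      exact this.2
    · filter_upwards [hfin] with ω hω
      have hs : ∀ w : Plane → ℝ, (∀ y, y ∉ B → w y = 0) → ∏ᶠ i, (1 - w (x i ω)) =
          ∏ i ∈ hω.toFinset, (1 - w (x i ω)) := by
        refine fun w hw => finprod_eq_prod_of_mulSupport_subset _ fun i hi => ?_
        by_contra h
        have : x i ω ∉ B := by simpa using h
        exact hi (by simp [hw _ this])
      rw [hs q hqB]
      refine (tendsto_finsetProd _ fun i _ => (tendsto_quantize (hq0 (x i ω))).const_sub 1).congr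
        fun n => ?_
      exact (hs (fun y => quantize n (q y)) (hqn0 n)).symm
  have hR : Tendsto (fun n => ∫ y, quantize n (q y)) atTop (𝓝 (∫ y, q y)) := by
    refine tendsto_integral_of_dominated_convergence (B.indicator fun _ => (1 : ℝ))
      (fun n => ((measurable_quantize n).comp hqm).aestronglyMeasurable)
      ((integrable_indicator_iff hB).2 (integrableOn_const hB')) (fun n => .of_forall fun y => ?_)
      (.of_forall fun y => tendsto_quantize (hq0 y))
    rw [Real.norm_of_nonneg (quantize_nonneg _ _)]
    by_cases hy : y ∈ B
    · simpa [hy] using (quantize_le (hq0 y)).trans (hq1 y)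
    · simp [hy, hqn0 n y hy]
  refine tendsto_nhds_unique hL ?_
  simp_rw [hstep]
  exact (Real.continuous_exp.tendsto _).comp (hR.const_mul _)

end GeneratingFunctional

section Marked

variable {Ω : Type*} [MeasurableSpace Ω] {P : Measure Ω} {lam : ℝ} {x : ℕ → Ω → Plane}
  {Θ : ℕ → Ω → ℝ}

/-- The uniform distribution on `[0, 2π)`. -/
noncomputable def dirLaw : Measure ℝ := ProbabilityTheory.cond volume (Set.Ico 0 (2 * Real.pi))

instance : IsProbabilityMeasure dirLaw := by
  refine ProbabilityTheory.cond_isProbabilityMeasure_of_finite ?_ ?_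
  · simp [Real.pi_pos]
  · rw [Real.volume_Ico]
    exact ENNReal.ofReal_ne_top

lemma IsMobileNetwork.map_dir [IsProbabilityMeasure P] (hnet : IsMobileNetwork P lam x Θ) :
    P.map (fun ω i => Θ i ω) = Measure.infinitePi fun _ : ℕ => dirLaw := by
  rw [hnet.indep_dir.map_fun_eq_infinitePi_map hnet.measurable_dir]
  congr 1
  funext i
  exact hnet.uniform_dir i

/-- Void probabilities of the point process of positions marked with directions. -/
theorem IsMobileNetwork.void_probability [IsProbabilityMeasure P]
    (hnet : IsMobileNetwork P lam x Θ) (hlam : 0 ≤ lam) {A : Set (Plane × ℝ)}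
    (hA : MeasurableSet A) {B : Set Plane} (hB : MeasurableSet B) (hB' : volume B ≠ ⊤)
    (hAB : ∀ p ∈ A, p.1 ∈ B) :
    P.real {ω | ∀ i, (x i ω, Θ i ω) ∉ A} =
      Real.exp (-lam * ((volume : Measure Plane).prod dirLaw).real A) := by
  set q : Plane → ℝ := fun y => dirLaw.real (Prod.mk y ⁻¹' A) with hq
  have hqm : Measurable q := (measurable_measure_prodMk_left hA).ennreal_toReal
  have hqB : ∀ y, y ∉ B → q y = 0 := by
    intro y hy
    have : Prod.mk y ⁻¹' A = ∅ := Set.eq_empty_of_forall_notMem fun θ hθ => hy (hAB _ hθ)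
    simp [hq, this]
  have hint : ∫ y, q y = ((volume : Measure Plane).prod dirLaw).real A := by
    rw [measureReal_def, Measure.prod_apply hA, integral_eq_lintegral_of_nonneg_ae
      (.of_forall fun y => measureReal_nonneg) hqm.aestronglyMeasurable]
    congr 1
    refine lintegral_congr fun y => ?_
    simp [ofReal_measureReal]
  rw [← hint, ← hnet.ppp.generatingFunctional hlam hqm (fun y => measureReal_nonneg)
    (fun y => measureReal_le_one) hB hB' hqB]
  have hxm : Measurable fun ω i => x i ω := measurable_pi_lambda _ hnet.ppp.measurable
  have hΘm : Measurable fun ω i => Θ i ω := measurable_pi_lambda _ hnet.measurable_dir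
  have hE : MeasurableSet {p : (ℕ → Plane) × (ℕ → ℝ) | ∀ i, (p.1 i, p.2 i) ∉ A} := by
    have : {p : (ℕ → Plane) × (ℕ → ℝ) | ∀ i, (p.1 i, p.2 i) ∉ A} =
        ⋂ i, (fun p : (ℕ → Plane) × (ℕ → ℝ) => (p.1 i, p.2 i)) ⁻¹' Aᶜ := by
      ext; simp
    rw [this]
    refine MeasurableSet.iInter fun i => ?_
    exact Measurable.prodMk (by fun_prop) (by fun_prop) hA.compl
  have hlaw := (indepFun_iff_map_prod_eq_prod_map_map hxm.aemeasurable hΘm.aemeasurable).1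
    hnet.indep_pos_dir
  have h1 : P {ω | ∀ i, (x i ω, Θ i ω) ∉ A} =
      ∫⁻ ω, ∏' i, dirLaw (Prod.mk (x i ω) ⁻¹' Aᶜ) ∂P := by
    have : P {ω | ∀ i, (x i ω, Θ i ω) ∉ A} =
        P.map (fun ω => ((fun i => x i ω), (fun i => Θ i ω)))
          {p : (ℕ → Plane) × (ℕ → ℝ) | ∀ i, (p.1 i, p.2 i) ∉ A} :=
      (Measure.map_apply (hxm.prodMk hΘm) hE).symm
    rw [this, hlaw, Measure.prod_apply hE, hnet.map_dir, lintegral_map _ hxm]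
    · refine lintegral_congr fun ω => ?_
      rw [← Measure.infinitePi_pi_univ _ fun i => measurable_prodMk_left hA.compl]
      congr 1
      ext θ
      simp
    · exact measurable_measure_prodMk_left hE
  rw [measureReal_def, h1, integral_eq_lintegral_of_nonneg_ae]
  · congr 1
    refine lintegral_congr_ae ?_
    filter_upwards [hnet.ppp.ae_finite hlam hB hB'] with ω hω
    have hone : ∀ i, i ∉ hω.toFinset → q (x i ω) = 0 := fun i hi => hqB _ (by simpa using hi)
    have hcompl : ∀ i, dirLaw (Prod.mk (x i ω) ⁻¹' Aᶜ) = ENNReal.ofReal (1 - q (x i ω)) := by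
      intro i
      rw [Set.preimage_compl, ← ofReal_measureReal,
        probReal_compl_eq_one_sub (measurable_prodMk_left hA)]
    simp_rw [hcompl]
    rw [tprod_eq_prod (s := hω.toFinset) fun i hi => by simp [hone i hi],
      finprod_eq_prod_of_mulSupport_subset (s := hω.toFinset),
      ENNReal.ofReal_prod_of_nonneg fun i _ => sub_nonneg.2 measureReal_le_one]
    intro i hi
    by_contra h
    exact hi (by simp [hone i h])
  · exact .of_forall fun ω => (finprod_mem_unit fun i =>
      ⟨sub_nonneg.2 measureReal_le_one, sub_le_self _ measureReal_nonneg⟩).1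
  · refine aestronglyMeasurable_finprod (w := fun y => 1 - q y) hnet.ppp.measurable
      (hqm.const_sub 1) ?_
    filter_upwards [hnet.ppp.ae_finite hlam hB hB'] with ω hω
    refine hω.subset fun i hi => ?_
    by_contra h
    exact hi (by rw [hqB _ h, sub_zero])

end Marked

section Geometry

/-- The planar position reached from `y` by a displacement of length `d` in direction `θ`. -/
noncomputable def displace (d : ℝ) (y : Plane) (θ : ℝ) : Plane :=
  !₂[y 0 + d * Real.cos θ, y 1 + d * Real.sin θ]

/-- Distances to the origin before and after a displacement. -/
noncomputable def distPair (d : ℝ) (p : Plane × ℝ) : ℝ × ℝ := (‖p.1‖, ‖displace d p.1 p.2‖)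

lemma norm_plane (y : Plane) : ‖y‖ = Real.sqrt (y 0 ^ 2 + y 1 ^ 2) := by
  simp [EuclideanSpace.norm_eq]

lemma measurable_distPair (d : ℝ) : Measurable (distPair d) := by
  unfold distPair
  refine measurable_fst.norm.prodMk ?_
  simp only [norm_plane, displace]
  simp only [Matrix.cons_val_zero, Matrix.cons_val_one]
  fun_prop

/-- Image of planar Lebesgue measure under the distances to two points at distance `|d|`. -/
noncomputable def distLaw (d : ℝ) : Measure (ℝ × ℝ) :=
  (volume : Measure ℂ).map fun w : ℂ => (‖w‖, ‖w - d‖)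

lemma measurable_dists (d : ℝ) : Measurable fun w : ℂ => (‖w‖, ‖w - d‖) := by fun_prop

/-- Rotation of the plane by `θ + π`, as a map from the complex numbers. -/
noncomputable def rotateNeg (θ : ℝ) : ℂ ≃ₗᵢ[ℝ] Plane :=
  ((rotation (Circle.exp θ)).trans (LinearIsometryEquiv.neg ℝ)).trans
    Complex.orthonormalBasisOneI.repr

lemma norm_displace_rotateNeg (d θ : ℝ) (w : ℂ) : ‖displace d (rotateNeg θ w) θ‖ = ‖w - d‖ := by
  have h : displace d (rotateNeg θ w) θ = rotateNeg θ (w - d) := by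
    ext i
    fin_cases i <;>
      simp [displace, rotateNeg, Complex.exp_re, Complex.exp_im] <;> ring
  rw [h, LinearIsometryEquiv.norm_map]

/-- The distances of a uniform point before and after a displacement in a uniform direction. -/
lemma map_distPair (d : ℝ) :
    ((volume : Measure Plane).prod dirLaw).map (distPair d) = distLaw d := by
  refine Measure.ext fun S hS => ?_
  rw [Measure.map_apply (measurable_distPair d) hS,
    Measure.prod_apply_symm (measurable_distPair d hS)]
  have : ∀ θ, (volume : Measure Plane) ((fun y => (y, θ)) ⁻¹' (distPair d ⁻¹' S)) =
      distLaw d S := by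
    intro θ
    have hm : MeasurableSet ((fun y : Plane => (y, θ)) ⁻¹' (distPair d ⁻¹' S)) :=
      measurable_prodMk_right (measurable_distPair d hS)
    rw [← (rotateNeg θ).measurePreserving.measure_preimage hm.nullMeasurableSet, distLaw,
      Measure.map_apply (measurable_dists d) hS]
    congr 1
    ext w
    simp [distPair, norm_displace_rotateNeg]
  simp [this]

lemma map_swap_distLaw (d : ℝ) : (distLaw d).map Prod.swap = distLaw d := by
  rw [distLaw, Measure.map_map measurable_swap (measurable_dists d)]
  have h : MeasurePreserving (fun w : ℂ => (d : ℂ) - w) volume volume :=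
    Measure.measurePreserving_sub_left volume (d : ℂ)
  conv_rhs => rw [← h.map_eq]
  rw [Measure.map_map (measurable_dists d) h.measurable]
  congr 1
  ext w <;> simp [norm_sub_rev]

lemma distLaw_fst_le (d : ℝ) (u : ℝ) :
    distLaw d {p | p.1 ≤ u} = ENNReal.ofReal u ^ 2 * NNReal.pi := by
  rw [distLaw, Measure.map_apply (measurable_dists d) (measurableSet_le (by fun_prop) (by fun_prop)),
    ← Complex.volume_closedBall 0 u]
  congr 1
  ext w
  simp

lemma distLaw_fst_eq (d : ℝ) (u : ℝ) : distLaw d {p | p.1 = u} = 0 := by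
  rw [distLaw, Measure.map_apply (measurable_dists d)
    (measurableSet_eq_fun (by fun_prop) (by fun_prop)), ← Measure.addHaar_sphere volume (0 : ℂ) u]
  congr 1
  ext w
  simp

lemma distLaw_snd_le (d : ℝ) (u : ℝ) :
    distLaw d {p | p.2 ≤ u} = ENNReal.ofReal u ^ 2 * NNReal.pi := by
  rw [← distLaw_fst_le d, ← map_swap_distLaw, Measure.map_apply measurable_swap
    (measurableSet_le (by fun_prop) (by fun_prop)), map_swap_distLaw]
  rfl

lemma distLaw_fst_le_ne_top (d u : ℝ) : distLaw d {p | p.1 ≤ u} ≠ ⊤ := by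
  rw [distLaw_fst_le]; finiteness

lemma distLaw_snd_le_ne_top (d u : ℝ) : distLaw d {p | p.2 ≤ u} ≠ ⊤ := by
  rw [distLaw_snd_le]; finiteness

lemma distLaw_union_ne_top (d u r : ℝ) : distLaw d {p | p.1 ≤ u ∨ p.2 ≤ r} ≠ ⊤ :=
  ((measure_union_le {p : ℝ × ℝ | p.1 ≤ u} {p | p.2 ≤ r}).trans_lt
    (ENNReal.add_lt_top.2 ⟨(distLaw_fst_le_ne_top d u).lt_top,
      (distLaw_snd_le_ne_top d r).lt_top⟩)).ne

lemma distLaw_ae_nonneg (d : ℝ) : ∀ᵐ p ∂distLaw d, 0 ≤ p.1 ∧ 0 ≤ p.2 := by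
  have hm : MeasurableSet {p : ℝ × ℝ | 0 ≤ p.1 ∧ 0 ≤ p.2} :=
    (measurableSet_le measurable_const measurable_fst).inter
      (measurableSet_le measurable_const measurable_snd)
  exact (ae_map_iff (measurable_dists d).aemeasurable hm).2
    (.of_forall fun w => ⟨norm_nonneg _, norm_nonneg _⟩)

instance (d : ℝ) : SFinite (distLaw d) := by unfold distLaw; infer_instance

lemma norm_polarCoord_sub {d ρ φ : ℝ} :
    ‖Complex.polarCoord.symm (ρ, φ) - d‖ =
      Real.sqrt (ρ ^ 2 + d ^ 2 - 2 * ρ * d * Real.cos φ) := by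
  rw [Complex.polarCoord_symm_apply, Complex.norm_eq_sqrt_sq_add_sq]
  congr 1
  simp [Complex.cos_ofReal_re, Complex.sin_ofReal_re]
  linear_combination ρ ^ 2 * Real.sin_sq_add_cos_sq φ

/-- Integration against `distLaw` in polar coordinates. -/
lemma lintegral_distLaw (d : ℝ) {f : ℝ × ℝ → ENNReal} (hf : Measurable f) :
    ∫⁻ p, f p ∂distLaw d =
      ∫⁻ ρ in Set.Ioi 0, ∫⁻ φ in Set.Ioo (-Real.pi) Real.pi,
        ENNReal.ofReal ρ * f (ρ, Real.sqrt (ρ ^ 2 + d ^ 2 - 2 * ρ * d * Real.cos φ)) := by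
  rw [distLaw, lintegral_map hf (measurable_dists d), ← Complex.lintegral_comp_polarCoord_symm,
    polarCoord_target, Measure.volume_eq_prod]
  refine Eq.trans ?_ (setLIntegral_prod (fun p : ℝ × ℝ => ENNReal.ofReal p.1 *
    f (p.1, Real.sqrt (p.1 ^ 2 + d ^ 2 - 2 * p.1 * d * Real.cos p.2))) ?_)
  · refine setLIntegral_congr_fun (measurableSet_Ioi.prod measurableSet_Ioo) fun p hp => ?_
    obtain ⟨ρ, φ⟩ := p
    have hρ : 0 < ρ := hp.1
    simp only [smul_eq_mul, norm_polarCoord_sub, Complex.norm_polarCoord_symm, abs_of_pos hρ]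
  · fun_prop

/-- Area of the part of the disc of radius `r` around a point that lies at distance more than `u`
from another point, at distance `d` of the first one. -/
noncomputable def discDiffArea (d u r : ℝ) : ℝ :=
  ∫ ρ in (0 : ℝ)..r, 2 * ρ * Real.arccos ((u ^ 2 - ρ ^ 2 - d ^ 2) / (2 * ρ * d))

lemma volume_cos_lt (c : ℝ) :
    volume ({φ | Real.cos φ < c} ∩ Set.Ioo (-Real.pi) Real.pi) =
      ENNReal.ofReal (2 * Real.arccos (-c)) := by
  have hsub : (Set.Ioo (-Real.pi) (-Real.arccos c) ∪ Set.Ioo (Real.arccos c) Real.pi : Set ℝ) =ᵐ[volume]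
      ({φ | Real.cos φ < c} ∩ Set.Ioo (-Real.pi) Real.pi : Set ℝ) := by
    have h0 : ∀ᵐ φ : ℝ, φ ≠ 0 := by simp [ae_iff]
    filter_upwards [h0] with φ h0
    refine propext ?_
    change (φ ∈ Set.Ioo _ _ ∨ φ ∈ Set.Ioo _ _) ↔ (Real.cos φ < c ∧ φ ∈ Set.Ioo _ _)
    have key : |φ| < Real.pi → (Real.cos φ < c ↔ Real.arccos c < |φ|) := by
      intro hφ
      have hpos : 0 < |φ| := abs_pos.2 h0
      rw [← Real.cos_abs]
      rcases le_or_gt c (-1) with hc | hc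
      · rw [Real.arccos_of_le_neg_one hc]
        exact iff_of_false (not_lt.2 (hc.trans (Real.neg_one_le_cos _))) (not_lt.2 hφ.le)
      rcases lt_or_ge 1 c with hc1 | hc1
      · rw [Real.arccos_of_one_le hc1.le]
        exact iff_of_true ((Real.cos_le_one _).trans_lt hc1) hpos
      conv_lhs => rw [← Real.cos_arccos hc.le hc1]
      exact Real.strictAntiOn_cos.lt_iff_gt ⟨hpos.le, hφ.le⟩
        ⟨Real.arccos_nonneg _, Real.arccos_le_pi _⟩
    have ha := Real.arccos_nonneg c
    constructor
    · rintro (⟨h1, h2⟩ | ⟨h1, h2⟩)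
      · have hn : |φ| = -φ := abs_of_neg (by linarith)
        exact ⟨(key (by linarith)).2 (by linarith), h1, by linarith [Real.pi_pos]⟩
      · have hn : |φ| = φ := abs_of_pos (by linarith)
        exact ⟨(key (by linarith)).2 (by linarith), by linarith [Real.pi_pos], h2⟩
    · rintro ⟨h, h1, h2⟩
      have := (key (abs_lt.2 ⟨h1, h2⟩)).1 h
      rcases lt_abs.1 this with h3 | h3
      · exact Or.inr ⟨h3, h2⟩
      · exact Or.inl ⟨h1, by linarith⟩
  have ha := Real.arccos_nonneg c
  have hp := Real.arccos_le_pi c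
  rw [← measure_congr hsub, measure_union _ measurableSet_Ioo, Real.volume_Ioo, Real.volume_Ioo,
    ← ENNReal.ofReal_add (by linarith) (by linarith), Real.arccos_neg]
  · ring_nf
  · exact Set.disjoint_left.2 fun φ h h' => by linarith [h.2, h'.1]

lemma intervalIntegrable_discDiff (d u a b : ℝ) : IntervalIntegrable
    (fun ρ => 2 * ρ * Real.arccos ((u ^ 2 - ρ ^ 2 - d ^ 2) / (2 * ρ * d))) volume a b := by
  refine IntervalIntegrable.continuousOn_mul (f := fun ρ =>
    Real.arccos ((u ^ 2 - ρ ^ 2 - d ^ 2) / (2 * ρ * d))) ?_ (by fun_prop)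
  refine (intervalIntegrable_const (c := Real.pi)).mono_fun
    (Measurable.aestronglyMeasurable ?_) (.of_forall fun ρ => ?_)
  · exact Real.continuous_arccos.measurable.comp (by fun_prop)
  · dsimp only
    rw [Real.norm_of_nonneg (Real.arccos_nonneg _), Real.norm_of_nonneg Real.pi_pos.le]
    exact Real.arccos_le_pi _

lemma discDiffArea_nonneg {d u r : ℝ} (hr : 0 ≤ r) : 0 ≤ discDiffArea d u r :=
  intervalIntegral.integral_nonneg hr fun _ hρ =>
    mul_nonneg (mul_nonneg zero_le_two hρ.1) (Real.arccos_nonneg _)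

lemma distLaw_diff {d u r : ℝ} (hd : 0 < d) (hu : 0 ≤ u) (hr : 0 ≤ r) :
    distLaw d {p | p.2 ≤ r ∧ u < p.1} = ENNReal.ofReal (discDiffArea d u r) := by
  have hS : MeasurableSet {p : ℝ × ℝ | p.1 ≤ r ∧ u < p.2} :=
    (measurableSet_le measurable_fst measurable_const).inter
      (measurableSet_lt measurable_const measurable_snd)
  have h1 : distLaw d {p | p.2 ≤ r ∧ u < p.1} = distLaw d {p | p.1 ≤ r ∧ u < p.2} := by
    rw [← map_swap_distLaw, Measure.map_apply measurable_swap hS, map_swap_distLaw]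
    rfl
  rw [h1, ← lintegral_indicator_one hS, lintegral_distLaw d (measurable_one.indicator hS),
    discDiffArea, intervalIntegral.integral_of_le hr,
    ofReal_integral_eq_lintegral_ofReal
      ((intervalIntegrable_iff_integrableOn_Ioc_of_le hr).1 (intervalIntegrable_discDiff d u 0 r))]
  · rw [← Set.Ioi_inter_Iic, Set.inter_comm, ← Measure.restrict_restrict measurableSet_Iic,
      ← lintegral_indicator measurableSet_Iic]
    refine setLIntegral_congr_fun measurableSet_Ioi fun ρ (hρ : 0 < ρ) => ?_
    rw [lintegral_const_mul' _ _ ENNReal.ofReal_ne_top]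
    by_cases hρr : ρ ≤ r
    · rw [Set.indicator_of_mem (show ρ ∈ Set.Iic r from hρr)]
      have hcos : ∀ φ, u < Real.sqrt (ρ ^ 2 + d ^ 2 - 2 * ρ * d * Real.cos φ) ↔
          Real.cos φ < (ρ ^ 2 + d ^ 2 - u ^ 2) / (2 * ρ * d) := by
        intro φ
        rw [Real.lt_sqrt hu, lt_div_iff₀ (by positivity)]
        constructor <;> intro h <;> linarith
      have : ∀ φ, ({p : ℝ × ℝ | p.1 ≤ r ∧ u < p.2}.indicator (1 : ℝ × ℝ → ENNReal)
          (ρ, Real.sqrt (ρ ^ 2 + d ^ 2 - 2 * ρ * d * Real.cos φ))) =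
          {φ | Real.cos φ < (ρ ^ 2 + d ^ 2 - u ^ 2) / (2 * ρ * d)}.indicator 1 φ := by
        intro φ
        by_cases h : Real.cos φ < (ρ ^ 2 + d ^ 2 - u ^ 2) / (2 * ρ * d)
        · rw [Set.indicator_of_mem, Set.indicator_of_mem]
          · rfl
          · exact h
          · exact ⟨hρr, (hcos φ).2 h⟩
        · rw [Set.indicator_of_notMem, Set.indicator_of_notMem]
          · exact h
          · exact fun h' => h ((hcos φ).1 h'.2)
      simp_rw [this]
      have hm : MeasurableSet {φ | Real.cos φ < (ρ ^ 2 + d ^ 2 - u ^ 2) / (2 * ρ * d)} :=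
        measurableSet_lt (by fun_prop) (by fun_prop)
      rw [lintegral_indicator_one hm, Measure.restrict_apply hm, volume_cos_lt,
        ← ENNReal.ofReal_mul hρ.le, ← neg_div]
      congr 1
      ring_nf
    · rw [Set.indicator_of_notMem (show ρ ∉ Set.Iic r from hρr)]
      have : ∀ φ, ({p : ℝ × ℝ | p.1 ≤ r ∧ u < p.2}.indicator (1 : ℝ × ℝ → ENNReal)
          (ρ, Real.sqrt (ρ ^ 2 + d ^ 2 - 2 * ρ * d * Real.cos φ))) = 0 := fun φ =>
        Set.indicator_of_notMem (fun h => hρr h.1) _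
      simp [this]
  · refine (ae_restrict_iff' measurableSet_Ioc).2 (.of_forall fun ρ hρ => ?_)
    exact mul_nonneg (mul_nonneg zero_le_two hρ.1.le) (Real.arccos_nonneg _)

/-- Area of the union of two discs. -/
theorem distLaw_real_union {d u r : ℝ} (hd : 0 < d) (hu : 0 ≤ u) (hr : 0 ≤ r) :
    (distLaw d).real {p | p.1 ≤ u ∨ p.2 ≤ r} = Real.pi * u ^ 2 + discDiffArea d u r := by
  have : {p : ℝ × ℝ | p.1 ≤ u ∨ p.2 ≤ r} = {p | p.1 ≤ u} ∪ {p | p.2 ≤ r ∧ u < p.1} := by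
    ext p
    simp only [Set.mem_ofPred_eq, Set.mem_union]
    constructor
    · rintro (h | h)
      · exact Or.inl h
      · rcases le_or_gt p.1 u with h' | h'
        exacts [Or.inl h', Or.inr ⟨h, h'⟩]
    · rintro (h | h)
      exacts [Or.inl h, Or.inr h.1]
  rw [measureReal_def, this, measure_union, distLaw_fst_le, distLaw_diff hd hu hr,
    ENNReal.toReal_add (by finiteness) (by finiteness),
    ENNReal.toReal_ofReal (discDiffArea_nonneg hr)]
  · simp [hu, mul_comm]
  · exact Set.disjoint_left.2 fun p (h : _ ≤ _) h' => not_lt.2 h h'.2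
  · exact (measurableSet_le measurable_snd measurable_const).inter
      (measurableSet_lt measurable_const measurable_fst)

end Geometry

section NoTies

variable {Ω : Type*} [MeasurableSpace Ω] {P : Measure Ω} {lam : ℝ} {x : ℕ → Ω → Plane}

/-- Index of the annulus of width `1 / (n + 1)` that contains a point. -/
noncomputable def cell (n : ℕ) (a : ℝ) : ℕ := ⌊(n + 1 : ℝ) * a⌋₊

lemma measurable_cell (n : ℕ) : Measurable (cell n) :=
  Nat.measurable_floor.comp (measurable_const_mul _)

lemma cell_mono (n : ℕ) : Monotone (cell n) := fun _ _ h =>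
  Nat.floor_mono (mul_le_mul_of_nonneg_left h (by positivity))

lemma cell_lt_of_add_le {n : ℕ} {a b : ℝ} (ha : 0 ≤ a) (h : a + 1 / (n + 1) ≤ b) :
    cell n a < cell n b := by
  have hn : (0 : ℝ) < n + 1 := by positivity
  refine Nat.lt_of_succ_le (Nat.le_floor ?_)
  have h1 : (cell n a : ℝ) ≤ (n + 1) * a := Nat.floor_le (by positivity)
  have h2 := mul_le_mul_of_nonneg_left h hn.le
  rw [mul_add, mul_one_div_cancel hn.ne'] at h2
  push_cast
  linarith

lemma lt_of_cell_le {n k : ℕ} {a : ℝ} (h : cell n a ≤ k) : (n + 1) * a < k + 1 := by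
  have h1 : (n + 1 : ℝ) * a < cell n a + 1 := Nat.lt_floor_add_one _
  have h2 : (cell n a : ℝ) ≤ k := by exact_mod_cast h
  linarith

lemma lt_add_one_of_cell_le {n : ℕ} {a b : ℝ} (hb : 0 ≤ b) (h : cell n a ≤ cell n b) :
    a < b + 1 := by
  have h1 := lt_of_cell_le h
  have h2 : (cell n b : ℝ) ≤ (n + 1) * b := Nat.floor_le (by positivity)
  have hn : (1 : ℝ) ≤ n + 1 := by simp
  nlinarith

lemma eventually_cell_lt {a b : ℝ} (ha : 0 ≤ a) (h : a < b) :
    ∀ᶠ n in atTop, cell n a < cell n b := by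
  have := (tendsto_one_div_add_atTop_nhds_zero_nat (𝕜 := ℝ)).eventually
    (gt_mem_nhds (sub_pos.2 h))
  filter_upwards [this] with n hn
  exact cell_lt_of_add_le ha (by linarith)

lemma eventually_cell_le_iff {a b : ℝ} (hb : 0 ≤ b) :
    ∀ᶠ n in atTop, cell n a ≤ cell n b ↔ a ≤ b := by
  rcases le_or_gt a b with h | h
  · exact .of_forall fun n => iff_of_true (cell_mono n h) h
  · filter_upwards [eventually_cell_lt hb h] with n hn
    exact iff_of_false (not_le.2 hn) (not_le.2 h)

lemma volume_annulus (n k : ℕ) :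
    volume {y : Plane | cell n ‖y‖ = k} ≤
      ENNReal.ofReal (Real.pi * (2 * k + 1) / (n + 1) ^ 2) := by
  have hn : (0 : ℝ) < n + 1 := by positivity
  have hsub : {y : Plane | cell n ‖y‖ = k} ⊆
      Metric.ball 0 ((k + 1) / (n + 1)) \ Metric.ball 0 (k / (n + 1)) := by
    intro y (hy : cell n ‖y‖ = k)
    have h1 := lt_of_cell_le hy.le
    have h2 : (cell n ‖y‖ : ℝ) ≤ (n + 1) * ‖y‖ := Nat.floor_le (by positivity)
    rw [hy] at h2
    constructor
    · rw [mem_ball_zero_iff, lt_div_iff₀ hn]; linarith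
    · rw [mem_ball_zero_iff, not_lt, div_le_iff₀ hn]; linarith
  refine (measure_mono hsub).trans ?_
  rw [measure_sdiff (Metric.ball_subset_ball (by gcongr; linarith))
    measurableSet_ball.nullMeasurableSet measure_ball_lt_top.ne,
    EuclideanSpace.volume_ball_fin_two, EuclideanSpace.volume_ball_fin_two]
  rw [← ENNReal.ofReal_pow (by positivity), ← ENNReal.ofReal_pow (by positivity)]
  rw [← ENNReal.ofReal_mul (by positivity),
    ← ENNReal.ofReal_mul (by positivity), ← ENNReal.ofReal_sub _ (by positivity)]
  refine ENNReal.ofReal_le_ofReal (le_of_eq ?_)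
  field_simp
  ring

lemma IsHomogeneousPPP.prob_tie_le [IsProbabilityMeasure P] (hx : IsHomogeneousPPP P lam x)
    (hlam : 0 ≤ lam) (K n : ℕ) :
    P {ω | ∃ i j, i ≠ j ∧ ‖x i ω‖ = ‖x j ω‖ ∧ ‖x i ω‖ < K} ≤
      ENNReal.ofReal (K * (lam * Real.pi * (2 * K)) ^ 2 * (1 / ((n : ℝ) + 1))) := by
  have hn : (0 : ℝ) < n + 1 := by positivity
  have hm : ∀ k, MeasurableSet {y : Plane | cell n ‖y‖ = k} := fun k =>
    ((measurable_cell n).comp measurable_norm) (MeasurableSet.singleton k)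
  have hfin : ∀ k, volume {y : Plane | cell n ‖y‖ = k} ≠ ⊤ := fun k =>
    ((volume_annulus n k).trans_lt ENNReal.ofReal_lt_top).ne
  have hsub : {ω | ∃ i j, i ≠ j ∧ ‖x i ω‖ = ‖x j ω‖ ∧ ‖x i ω‖ < K} ⊆
      ⋃ k ∈ Finset.range (K * (n + 1)), {ω | 2 ≤ count x {y | cell n ‖y‖ = k} ω} := by
    rintro ω ⟨i, j, hij, h, hK⟩
    refine Set.mem_biUnion (x := cell n ‖x i ω‖) ?_ ?_
    · have h2 : (cell n ‖x i ω‖ : ℝ) ≤ (n + 1) * ‖x i ω‖ := Nat.floor_le (by positivity)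
      have h3 : (cell n ‖x i ω‖ : ℝ) < (K * (n + 1) : ℕ) := by push_cast; nlinarith
      simpa using (by exact_mod_cast h3 : cell n ‖x i ω‖ < K * (n + 1))
    · change (2 : ℕ∞) ≤ Set.encard _
      rw [← Set.encard_pair hij]
      refine Set.encard_le_encard ?_
      rintro l (rfl | rfl)
      · rfl
      · change cell n ‖x l ω‖ = _
        rw [h]
  refine (measure_mono hsub).trans ((measure_biUnion_finset_le _ _).trans ?_)
  have hterm : ∀ k ∈ Finset.range (K * (n + 1)),
      P {ω | 2 ≤ count x {y | cell n ‖y‖ = k} ω} ≤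
        ENNReal.ofReal ((lam * Real.pi * (2 * K) / (n + 1)) ^ 2) := by
    intro k hk
    refine (hx.prob_two_le_count hlam (hm k) (hfin k)).trans (ENNReal.ofReal_le_ofReal ?_)
    have hv : volume.real {y : Plane | cell n ‖y‖ = k} ≤ Real.pi * (2 * k + 1) / (n + 1) ^ 2 :=
      ENNReal.toReal_le_of_le_ofReal (by positivity) (volume_annulus n k)
    have hk' : (k + 1 : ℝ) ≤ K * (n + 1) := by exact_mod_cast Finset.mem_range.1 hk
    have hv' : volume.real {y : Plane | cell n ‖y‖ = k} ≤ Real.pi * (2 * K) / (n + 1) := by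
      refine hv.trans ?_
      rw [div_le_div_iff₀ (by positivity) hn]
      have : 2 * (k : ℝ) + 1 ≤ 2 * K * (n + 1) := by nlinarith
      calc Real.pi * (2 * k + 1) * (n + 1) ≤ Real.pi * (2 * K * (n + 1)) * (n + 1) := by gcongr
        _ = _ := by ring
    calc (lam * volume.real {y : Plane | cell n ‖y‖ = k}) ^ 2
        ≤ (lam * (Real.pi * (2 * K) / (n + 1))) ^ 2 := by gcongr
      _ = _ := by ring
  refine (Finset.sum_le_sum hterm).trans (le_of_eq ?_)
  rw [Finset.sum_const, Finset.card_range, ← ENNReal.ofReal_nsmul]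
  congr 1
  rw [nsmul_eq_mul]
  push_cast
  field_simp

lemma IsHomogeneousPPP.ae_no_tie [IsProbabilityMeasure P] (hx : IsHomogeneousPPP P lam x)
    (hlam : 0 ≤ lam) : ∀ᵐ ω ∂P, ∀ i j, ‖x i ω‖ = ‖x j ω‖ → i = j := by
  have hK : ∀ K : ℕ, P {ω | ∃ i j, i ≠ j ∧ ‖x i ω‖ = ‖x j ω‖ ∧ ‖x i ω‖ < K} = 0 := by
    intro K
    refine le_antisymm (ge_of_tendsto' (x := atTop) ?_ fun n => hx.prob_tie_le hlam K n) zero_le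
    have := ENNReal.tendsto_ofReal ((tendsto_one_div_add_atTop_nhds_zero_nat (𝕜 := ℝ)).const_mul
      (K * (lam * Real.pi * (2 * K)) ^ 2))
    simpa using this
  have h := ae_all_iff.2 fun K => measure_eq_zero_iff_ae_notMem.1 (hK K)
  filter_upwards [h] with ω hω i j hij
  by_contra hne
  obtain ⟨K, hK⟩ := exists_nat_gt ‖x i ω‖
  exact hω K ⟨i, j, hne, hij, hK⟩

lemma IsHomogeneousPPP.ae_locallyFinite [IsProbabilityMeasure P] (hx : IsHomogeneousPPP P lam x)
    (hlam : 0 ≤ lam) : ∀ᵐ ω ∂P, ∀ K : ℝ, {i | ‖x i ω‖ ≤ K}.Finite := by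
  have h : ∀ᵐ ω ∂P, ∀ K : ℕ, {i | x i ω ∈ Metric.closedBall 0 K}.Finite :=
    ae_all_iff.2 fun K => hx.ae_finite hlam measurableSet_closedBall measure_closedBall_lt_top.ne
  filter_upwards [h] with ω hω K
  obtain ⟨K', hK'⟩ := exists_nat_ge K
  refine (hω K').subset fun i hi => ?_
  have : ‖x i ω‖ ≤ K := hi
  simpa using this.trans hK'

/-- Almost surely a unique point is closest to the origin. -/
lemma IsHomogeneousPPP.ae_exists_closest [IsProbabilityMeasure P] (hx : IsHomogeneousPPP P lam x)
    (hlam : 0 ≤ lam) : ∀ᵐ ω ∂P, ∃ i, ∀ j, j ≠ i → ‖x i ω‖ < ‖x j ω‖ := by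
  filter_upwards [hx.ae_locallyFinite hlam, hx.ae_no_tie hlam] with ω hfin htie
  obtain ⟨i, hi, hmin⟩ := (hfin ‖x 0 ω‖).exists_minimalFor (fun i => ‖x i ω‖) _
    ⟨0, le_refl ‖x 0 ω‖⟩
  refine ⟨i, fun j hj => lt_of_le_of_ne ?_ fun h => hj (htie i j h).symm⟩
  by_contra h
  rw [not_le] at h
  exact not_le.2 h (hmin (show ‖x j ω‖ ≤ ‖x 0 ω‖ from h.le.trans hi) h.le)

end NoTies

section CellEvents

/-- Cell of a pair of distances. -/
noncomputable def cellPair (n : ℕ) (p : ℝ × ℝ) : ℕ × ℕ := (cell n p.1, cell n p.2)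

lemma measurable_cellPair (n : ℕ) : Measurable (cellPair n) :=
  ((measurable_cell n).comp measurable_fst).prodMk ((measurable_cell n).comp measurable_snd)

/-- Pairs of distances that share the cell `c`. -/
def sameCell (n : ℕ) (c : ℕ × ℕ) : Set (ℝ × ℝ) := {p | cellPair n p = c}

/-- Pairs of distances in a cell that is not strictly above `c` in both coordinates. -/
def lowCells (n : ℕ) (c : ℕ × ℕ) : Set (ℝ × ℝ) :=
  {p | (cellPair n p).1 ≤ c.1 ∨ (cellPair n p).2 ≤ c.2}

lemma measurableSet_sameCell (n : ℕ) (c : ℕ × ℕ) : MeasurableSet (sameCell n c) :=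
  measurable_cellPair n (MeasurableSet.singleton c)

lemma measurableSet_lowCells (n : ℕ) (c : ℕ × ℕ) : MeasurableSet (lowCells n c) :=
  measurable_cellPair n (MeasurableSet.of_discrete (s := {c' : ℕ × ℕ | c'.1 ≤ c.1 ∨ c'.2 ≤ c.2}))

lemma sameCell_subset_lowCells (n : ℕ) (c : ℕ × ℕ) : sameCell n c ⊆ lowCells n c :=
  fun p (hp : cellPair n p = c) => Or.inl (by rw [hp])

lemma lowCells_subset (n : ℕ) (c : ℕ × ℕ) :
    lowCells n c ⊆ {p | p.1 ≤ c.1 + 1 ∨ p.2 ≤ c.2 + 1} := by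
  have key : ∀ {a : ℝ} {k : ℕ}, cell n a ≤ k → a ≤ k + 1 := by
    intro a k h
    have h1 := lt_of_cell_le h
    rcases le_or_gt a 0 with ha | ha
    · have : (0 : ℝ) ≤ k := by positivity
      linarith
    · have : (0 : ℝ) ≤ n := by positivity
      nlinarith
  rintro p (h | h)
  · exact Or.inl (key h)
  · exact Or.inr (key h)

lemma distLaw_lowCells_ne_top (d : ℝ) (n : ℕ) (c : ℕ × ℕ) : distLaw d (lowCells n c) ≠ ⊤ :=
  measure_ne_top_of_subset (lowCells_subset n c) (distLaw_union_ne_top d _ _)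

lemma distLaw_sameCell_ne_top (d : ℝ) (n : ℕ) (c : ℕ × ℕ) : distLaw d (sameCell n c) ≠ ⊤ :=
  measure_ne_top_of_subset (sameCell_subset_lowCells n c) (distLaw_lowCells_ne_top d n c)

variable {Ω : Type*} [MeasurableSpace Ω] {P : Measure Ω} {lam : ℝ} {x : ℕ → Ω → Plane}
  {Θ : ℕ → Ω → ℝ}

lemma norm_le_norm_displace (d : ℝ) (y : Plane) (θ : ℝ) : ‖y‖ ≤ ‖displace d y θ‖ + |d| := by
  have h : y = displace d y θ + displace (-d) 0 θ := by
    ext i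
    fin_cases i <;> simp [displace]
  have h2 : ‖displace (-d) 0 θ‖ = |d| := by
    rw [norm_plane]
    simp only [displace, Matrix.cons_val_zero, Matrix.cons_val_one, PiLp.zero_apply, zero_add]
    rw [← Real.sqrt_sq_eq_abs]
    congr 1
    linear_combination d ^ 2 * Real.sin_sq_add_cos_sq θ
  calc ‖y‖ = ‖displace d y θ + displace (-d) 0 θ‖ := by rw [← h]
    _ ≤ _ := norm_add_le _ _
    _ = _ := by rw [h2]

/-- Initial and final distances of the point with index `i`. -/
noncomputable def pairAt (d : ℝ) (x : ℕ → Ω → Plane) (Θ : ℕ → Ω → ℝ) (i : ℕ) (ω : Ω) : ℝ × ℝ :=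
  distPair d (x i ω, Θ i ω)

lemma IsMobileNetwork.measurable_pairAt (hnet : IsMobileNetwork P lam x Θ) (d : ℝ) (i : ℕ) :
    Measurable (pairAt d x Θ i) :=
  (measurable_distPair d).comp ((hnet.ppp.measurable i).prodMk (hnet.measurable_dir i))

/-- Void probabilities of the point process of initial and final distances. -/
lemma IsMobileNetwork.void_pairAt [IsProbabilityMeasure P] (hnet : IsMobileNetwork P lam x Θ)
    (hlam : 0 ≤ lam) (d : ℝ) {S : Set (ℝ × ℝ)} (hS : MeasurableSet S) {K L : ℝ}
    (hSK : S ⊆ {p | p.1 ≤ K ∨ p.2 ≤ L}) :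
    P.real {ω | ∀ i, pairAt d x Θ i ω ∉ S} = Real.exp (-lam * (distLaw d).real S) := by
  have h := hnet.void_probability hlam (A := distPair d ⁻¹' S) (measurable_distPair d hS)
    (B := Metric.closedBall 0 (max K (L + |d|))) measurableSet_closedBall
    measure_closedBall_lt_top.ne ?_
  · rw [measureReal_def (distLaw d), ← map_distPair d, Measure.map_apply (measurable_distPair d) hS]
    exact h
  · intro p hp
    rw [mem_closedBall_zero_iff]
    rcases hSK hp with h | h
    · exact le_max_of_le_left h
    · have h' : ‖displace d p.1 p.2‖ ≤ L := h
      exact le_max_of_le_right ((norm_le_norm_displace d p.1 p.2).trans (by linarith))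

/-- The cell `c` contains points, and all other points lie strictly above it in both
coordinates. -/
def cellEvent (d : ℝ) (x : ℕ → Ω → Plane) (Θ : ℕ → Ω → ℝ) (n : ℕ) (c : ℕ × ℕ) : Set Ω :=
  {ω | ∀ i, pairAt d x Θ i ω ∉ lowCells n c \ sameCell n c} \
    {ω | ∀ i, pairAt d x Θ i ω ∉ lowCells n c}

lemma measurableSet_void {d : ℝ} (hm : ∀ i, Measurable (pairAt d x Θ i)) {S : Set (ℝ × ℝ)}
    (hS : MeasurableSet S) : MeasurableSet {ω | ∀ i, pairAt d x Θ i ω ∉ S} := by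
  have : {ω | ∀ i, pairAt d x Θ i ω ∉ S} = ⋂ i, pairAt d x Θ i ⁻¹' Sᶜ := by ext; simp
  rw [this]
  exact MeasurableSet.iInter fun i => hm i hS.compl

lemma measurableSet_cellEvent {d : ℝ} (hm : ∀ i, Measurable (pairAt d x Θ i)) (n : ℕ)
    (c : ℕ × ℕ) : MeasurableSet (cellEvent d x Θ n c) :=
  (measurableSet_void hm ((measurableSet_lowCells n c).diff (measurableSet_sameCell n c))).diff
    (measurableSet_void hm (measurableSet_lowCells n c))

omit [MeasurableSpace Ω] in
lemma mem_cellEvent {d : ℝ} {n : ℕ} {c : ℕ × ℕ} {ω : Ω} :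
    ω ∈ cellEvent d x Θ n c ↔ (∃ i, cellPair n (pairAt d x Θ i ω) = c) ∧
      ∀ j, ((cellPair n (pairAt d x Θ j ω)).1 ≤ c.1 ∨ (cellPair n (pairAt d x Θ j ω)).2 ≤ c.2) →
        cellPair n (pairAt d x Θ j ω) = c := by
  have h1 : ω ∈ cellEvent d x Θ n c ↔
      (∀ j, pairAt d x Θ j ω ∈ lowCells n c → pairAt d x Θ j ω ∈ sameCell n c) ∧
      ∃ i, pairAt d x Θ i ω ∈ lowCells n c := by
    simp only [cellEvent, Set.mem_sdiff, Set.mem_ofPred_eq]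
    push Not
    rfl
  rw [h1]
  constructor
  · rintro ⟨h, i, hi⟩
    exact ⟨⟨i, h i hi⟩, h⟩
  · rintro ⟨⟨i, hi⟩, h⟩
    exact ⟨h, i, sameCell_subset_lowCells n c hi⟩

omit [MeasurableSpace Ω] in
lemma pairwise_disjoint_cellEvent (d : ℝ) (n : ℕ) :
    Pairwise fun c c' => Disjoint (cellEvent d x Θ n c) (cellEvent d x Θ n c') := by
  refine fun c c' hne => Set.disjoint_left.2 fun ω h h' => hne ?_
  obtain ⟨⟨i, hi⟩, h⟩ := mem_cellEvent.1 h
  obtain ⟨⟨j, hj⟩, h'⟩ := mem_cellEvent.1 h'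
  rcases le_total c.1 c'.1 with hle | hle
  · rw [← hi]
    exact h' i (Or.inl (by rw [hi]; exact hle))
  · rw [← hj]
    exact (h j (Or.inl (by rw [hj]; exact hle))).symm

lemma IsMobileNetwork.prob_cellEvent [IsProbabilityMeasure P] (hnet : IsMobileNetwork P lam x Θ)
    (hlam : 0 ≤ lam) (d : ℝ) (n : ℕ) (c : ℕ × ℕ) :
    P (cellEvent d x Θ n c) = ENNReal.ofReal
      (Real.exp (-lam * (distLaw d).real (lowCells n c \ sameCell n c)) *
        (1 - Real.exp (-(lam * (distLaw d).real (sameCell n c))))) := by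
  have hm := hnet.measurable_pairAt d
  have hA := measurableSet_lowCells n c
  have hC := measurableSet_sameCell n c
  have hsub : {ω | ∀ i, pairAt d x Θ i ω ∉ lowCells n c} ⊆
      {ω | ∀ i, pairAt d x Θ i ω ∉ lowCells n c \ sameCell n c} := fun ω hω i hi => hω i hi.1
  rw [← ofReal_measureReal, cellEvent, measureReal_sdiff hsub (measurableSet_void hm hA),
    hnet.void_pairAt hlam d (hA.diff hC) (Set.sdiff_subset.trans (lowCells_subset n c)),
    hnet.void_pairAt hlam d hA (lowCells_subset n c), mul_sub, mul_one, ← Real.exp_add]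
  congr 4
  rw [← measureReal_sdiff_add_inter hC (h := distLaw_lowCells_ne_top d n c),
    Set.inter_eq_self_of_subset_right (sameCell_subset_lowCells n c)]
  ring

end CellEvents

section CellLimit

/-- The function `(1 - exp (-a)) / a`, continuously extended to `0`. -/
noncomputable def expQuot (a : ℝ) : ℝ := if a = 0 then 1 else (1 - Real.exp (-a)) / a

lemma mul_expQuot (a : ℝ) : a * expQuot a = 1 - Real.exp (-a) := by
  unfold expQuot
  split_ifs with h
  · simp [h]
  · field_simp

lemma expQuot_mem {a : ℝ} (ha : 0 ≤ a) : expQuot a ∈ Set.Icc (Real.exp (-a)) 1 := by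
  unfold expQuot
  split_ifs with h
  · simp [h]
  · have hpos : 0 < a := lt_of_le_of_ne ha (Ne.symm h)
    constructor
    · rw [le_div_iff₀ hpos]
      have h1 := Real.add_one_le_exp a
      have h2 : Real.exp (-a) * Real.exp a = 1 := by rw [← Real.exp_add]; simp
      nlinarith [Real.exp_pos (-a)]
    · rw [div_le_one hpos]
      linarith [Real.add_one_le_exp (-a)]

lemma tendsto_expQuot {ι : Type*} {l : Filter ι} {f : ι → ℝ} (h0 : ∀ i, 0 ≤ f i)
    (hf : Tendsto f l (𝓝 0)) : Tendsto (fun i => expQuot (f i)) l (𝓝 1) := by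
  refine tendsto_of_tendsto_of_tendsto_of_le_of_le (g := fun i => Real.exp (-f i)) ?_
    tendsto_const_nhds (fun i => (expQuot_mem (h0 i)).1) (fun i => (expQuot_mem (h0 i)).2)
  have := (Real.continuous_exp.tendsto (-0)).comp hf.neg
  simpa [Function.comp_def] using this

/-- Density, relative to `distLaw d`, of the event that a cell holds points and all other points
lie strictly above it. -/
noncomputable def cellDensity (lam d : ℝ) (n : ℕ) (c : ℕ × ℕ) : ℝ :=
  lam * (Real.exp (-lam * (distLaw d).real (lowCells n c \ sameCell n c)) *
    expQuot (lam * (distLaw d).real (sameCell n c)))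

lemma lintegral_cellDensity (lam d : ℝ) (n : ℕ) :
    ∫⁻ p, ENNReal.ofReal (cellDensity lam d n (cellPair n p)) ∂distLaw d =
      ∑' c, ENNReal.ofReal
        (Real.exp (-lam * (distLaw d).real (lowCells n c \ sameCell n c)) *
          (1 - Real.exp (-(lam * (distLaw d).real (sameCell n c))))) := by
  rw [← lintegral_map (f := fun c => ENNReal.ofReal (cellDensity lam d n c))
    Measurable.of_discrete (measurable_cellPair n), lintegral_countable']
  refine tsum_congr fun c => ?_
  rw [Measure.map_apply (measurable_cellPair n) (MeasurableSet.singleton c)]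
  change _ * distLaw d (sameCell n c) = _
  rw [← ofReal_measureReal (distLaw_sameCell_ne_top d n c),
    ← ENNReal.ofReal_mul' measureReal_nonneg, ← mul_expQuot, cellDensity]
  congr 1
  ring

lemma real_distLaw_fst_le (d : ℝ) {u : ℝ} (hu : 0 ≤ u) :
    (distLaw d).real {p | p.1 ≤ u} = Real.pi * u ^ 2 := by
  rw [measureReal_def, distLaw_fst_le]
  simp [hu, mul_comm]

lemma tendsto_real_lowCells_diff (d : ℝ) {p : ℝ × ℝ} (hp : 0 ≤ p.1 ∧ 0 ≤ p.2) :
    Tendsto (fun n => (distLaw d).real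
      (lowCells n (cellPair n p) \ sameCell n (cellPair n p))) atTop
      (𝓝 ((distLaw d).real {q | q.1 ≤ p.1 ∨ q.2 ≤ p.2})) := by
  have hA : MeasurableSet {q : ℝ × ℝ | q.1 ≤ p.1 ∨ q.2 ≤ p.2} :=
    (measurableSet_le measurable_fst measurable_const).union
      (measurableSet_le measurable_snd measurable_const)
  have hB : MeasurableSet {q : ℝ × ℝ | q.1 ≤ p.1 + 1 ∨ q.2 ≤ p.2 + 1} :=
    (measurableSet_le measurable_fst measurable_const).union
      (measurableSet_le measurable_snd measurable_const)
  refine (ENNReal.tendsto_toReal (distLaw_union_ne_top d _ _)).comp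
    (tendsto_measure_of_ae_tendsto_indicator atTop hA
    (fun n => (measurableSet_lowCells n _).diff (measurableSet_sameCell n _)) hB
    (distLaw_union_ne_top d _ _) (.of_forall fun n q hq => ?_) ?_)
  · rcases hq.1 with h | h
    · exact Or.inl (lt_add_one_of_cell_le hp.1 h).le
    · exact Or.inr (lt_add_one_of_cell_le hp.2 h).le
  · have hne : ∀ᵐ q ∂distLaw d, q.1 ≠ p.1 :=
      measure_eq_zero_iff_ae_notMem.1 (distLaw_fst_eq d p.1)
    filter_upwards [hne, distLaw_ae_nonneg d] with q hq hq0
    have hcell : ∀ᶠ n in atTop, cell n q.1 ≠ cell n p.1 := by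
      rcases lt_or_gt_of_ne hq with h | h
      · exact (eventually_cell_lt hq0.1 h).mono fun n hn => hn.ne
      · exact (eventually_cell_lt hp.1 h).mono fun n hn => hn.ne'
    filter_upwards [hcell, eventually_cell_le_iff (a := q.1) hp.1,
      eventually_cell_le_iff (a := q.2) hp.2] with n h0 h1 h2
    change ((cell n q.1 ≤ cell n p.1 ∨ cell n q.2 ≤ cell n p.2) ∧ ¬ cellPair n q = cellPair n p) ↔
      (q.1 ≤ p.1 ∨ q.2 ≤ p.2)
    rw [h1, h2, and_iff_left]
    exact fun h => h0 (congrArg Prod.fst h)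

lemma tendsto_real_sameCell (d : ℝ) {p : ℝ × ℝ} (hp : 0 ≤ p.1 ∧ 0 ≤ p.2) :
    Tendsto (fun n => (distLaw d).real (sameCell n (cellPair n p))) atTop (𝓝 0) := by
  have hB : MeasurableSet {q : ℝ × ℝ | q.1 ≤ p.1 + 1} :=
    measurableSet_le measurable_fst measurable_const
  have := (ENNReal.tendsto_toReal (a := distLaw d ∅) (by simp)).comp
    (tendsto_measure_of_ae_tendsto_indicator (μ := distLaw d) atTop MeasurableSet.empty
    (As := fun n => sameCell n (cellPair n p))
    (fun n => measurableSet_sameCell n _) hB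
    (distLaw_fst_le_ne_top d _) (.of_forall fun n q hq => ?_) ?_)
  · simpa [Function.comp_def, measureReal_def] using this
  · exact (lt_add_one_of_cell_le hp.1 (congrArg Prod.fst (hq : cellPair n q = cellPair n p)).le).le
  · have hne : ∀ᵐ q ∂distLaw d, q.1 ≠ p.1 :=
      measure_eq_zero_iff_ae_notMem.1 (distLaw_fst_eq d p.1)
    filter_upwards [hne, distLaw_ae_nonneg d] with q hq hq0
    have hcell : ∀ᶠ n in atTop, cell n q.1 ≠ cell n p.1 := by
      rcases lt_or_gt_of_ne hq with h | h
      · exact (eventually_cell_lt hq0.1 h).mono fun n hn => hn.ne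
      · exact (eventually_cell_lt hp.1 h).mono fun n hn => hn.ne'
    filter_upwards [hcell] with n hn
    exact iff_of_false (fun h => hn (congrArg Prod.fst (h : cellPair n q = cellPair n p))) (by simp)

lemma cellDensity_le {lam : ℝ} (hlam : 0 ≤ lam) (d : ℝ) (n : ℕ) {p : ℝ × ℝ} (hp : 0 ≤ p.1) :
    cellDensity lam d n (cellPair n p) ≤
      lam * (Real.exp (lam * Real.pi) * Real.exp (-(lam * Real.pi / 2) * p.1 ^ 2)) := by
  have hlp : 0 ≤ lam * Real.pi := mul_nonneg hlam Real.pi_pos.le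
  refine mul_le_mul_of_nonneg_left ?_ hlam
  refine (mul_le_of_le_one_right (Real.exp_pos _).le
    (expQuot_mem (mul_nonneg hlam measureReal_nonneg)).2).trans ?_
  rw [← Real.exp_add, Real.exp_le_exp]
  rcases le_or_gt 1 p.1 with h1 | h1
  · have hsub : {q : ℝ × ℝ | q.1 ≤ p.1 - 1} ⊆
        lowCells n (cellPair n p) \ sameCell n (cellPair n p) := by
      intro q (hq : q.1 ≤ p.1 - 1)
      have hlt : cell n q.1 < cell n p.1 := by
        refine (cell_mono n (le_max_left q.1 0)).trans_lt (cell_lt_of_add_le (le_max_right _ _) ?_)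
        have hn : (1 : ℝ) / (n + 1) ≤ 1 := by
          rw [div_le_one (by positivity)]; simp
        rcases max_cases q.1 0 with ⟨h, _⟩ | ⟨h, _⟩ <;> rw [h] <;> linarith
      exact ⟨Or.inl hlt.le, fun h => hlt.ne (congrArg Prod.fst (h : cellPair n q = cellPair n p))⟩
    have hm := measureReal_mono (μ := distLaw d) hsub
      (measure_ne_top_of_subset Set.sdiff_subset (distLaw_lowCells_ne_top d n _))
    rw [real_distLaw_fst_le d (sub_nonneg.2 h1)] at hm
    have := mul_le_mul_of_nonneg_left hm hlam
    nlinarith [mul_nonneg hlp (sq_nonneg (p.1 - 2))]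
  · have h2 : 0 ≤ lam * (distLaw d).real
        (lowCells n (cellPair n p) \ sameCell n (cellPair n p)) :=
      mul_nonneg hlam measureReal_nonneg
    have h3 : p.1 ^ 2 ≤ 1 := by nlinarith
    nlinarith [mul_nonneg hlp (sub_nonneg.2 h3)]

lemma lintegral_gaussian_distLaw_ne_top {b : ℝ} (hb : 0 < b) (d : ℝ) (C : ℝ) :
    ∫⁻ p, ENNReal.ofReal (C * Real.exp (-b * p.1 ^ 2)) ∂distLaw d ≠ ⊤ := by
  rw [distLaw, lintegral_map (by fun_prop) (measurable_dists d)]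
  have h := GaussianFourier.integrable_cexp_neg_mul_sq_norm_add (V := ℂ) (b := (b : ℂ))
    (by simpa using hb) 0 0
  have h2 : Integrable (fun w : ℂ => C * Real.exp (-b * ‖w‖ ^ 2)) := by
    refine (h.norm.const_mul C).congr (.of_forall fun w => ?_)
    simp only [Complex.norm_exp]
    congr 2
    simp [← Complex.ofReal_pow]
  exact h2.lintegral_lt_top.ne

/-- Limit of the integrals of the cell densities. -/
lemma tendsto_lintegral_cellDensity {lam : ℝ} (hlam : 0 < lam) (d : ℝ) :
    Tendsto (fun n => ∫⁻ p, ENNReal.ofReal (cellDensity lam d n (cellPair n p)) ∂distLaw d) atTop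
      (𝓝 (∫⁻ p, ENNReal.ofReal
        (lam * Real.exp (-lam * (distLaw d).real {q | q.1 ≤ p.1 ∨ q.2 ≤ p.2})) ∂distLaw d)) := by
  refine tendsto_lintegral_of_dominated_convergence (fun p => ENNReal.ofReal
    (lam * Real.exp (lam * Real.pi) * Real.exp (-(lam * Real.pi / 2) * p.1 ^ 2))) (fun n => ?_)
    (fun n => ?_) (lintegral_gaussian_distLaw_ne_top (by positivity) d _) ?_
  · exact (Measurable.of_discrete (f := fun c => ENNReal.ofReal (cellDensity lam d n c))).comp
      (measurable_cellPair n)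
  · filter_upwards [distLaw_ae_nonneg d] with p hp
    refine ENNReal.ofReal_le_ofReal ?_
    rw [mul_assoc]
    exact cellDensity_le hlam.le d n hp.1
  · filter_upwards [distLaw_ae_nonneg d] with p hp
    refine ENNReal.tendsto_ofReal (Tendsto.const_mul _ ?_)
    rw [← mul_one (Real.exp _)]
    refine Tendsto.mul ?_ (tendsto_expQuot (fun n => mul_nonneg hlam.le measureReal_nonneg) ?_)
    · exact (Real.continuous_exp.tendsto _).comp ((tendsto_real_lowCells_diff d hp).const_mul _)
    · simpa using (tendsto_real_sameCell d hp).const_mul lam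

end CellLimit

section DominantPoint

variable {Ω : Type*} [MeasurableSpace Ω] {P : Measure Ω} {lam : ℝ} {x : ℕ → Ω → Plane}
  {Θ : ℕ → Ω → ℝ}

/-- Some point is strictly closest to the origin both initially and finally. -/
def dominantEvent (d : ℝ) (x : ℕ → Ω → Plane) (Θ : ℕ → Ω → ℝ) : Set Ω :=
  {ω | ∃ i, ∀ j, j ≠ i → (pairAt d x Θ i ω).1 < (pairAt d x Θ j ω).1 ∧
    (pairAt d x Θ i ω).2 < (pairAt d x Θ j ω).2}

lemma exists_gap {f : ℕ → ℝ} (hfin : ∀ K : ℝ, {i | f i ≤ K}.Finite) {i : ℕ}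
    (hi : ∀ j, j ≠ i → f i < f j) : ∃ δ > 0, ∀ j, j ≠ i → f i + δ ≤ f j := by
  classical
  have hev : ∀ᶠ δ in 𝓝[>] (0 : ℝ), ∀ j ∈ (hfin (f i + 1)).toFinset, j ≠ i → f i + δ ≤ f j := by
    refine (Finset.eventually_all _).2 fun j _ => ?_
    by_cases hj : j = i
    · simp [hj]
    · have : ∀ᶠ δ in 𝓝[>] (0 : ℝ), δ < f j - f i :=
        nhdsWithin_le_nhds (gt_mem_nhds (sub_pos.2 (hi j hj)))
      filter_upwards [this] with δ hδ _
      linarith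
  have hev1 : ∀ᶠ δ in 𝓝[>] (0 : ℝ), δ < 1 := nhdsWithin_le_nhds (gt_mem_nhds one_pos)
  obtain ⟨δ, ⟨h1, h2⟩, h3⟩ := ((hev.and hev1).and self_mem_nhdsWithin).exists
  refine ⟨δ, h3, fun j hj => ?_⟩
  by_cases hmem : f j ≤ f i + 1
  · exact h1 j (by simpa using hmem) hj
  · linarith

lemma eventually_forall_cell_lt {f : ℕ → ℝ} (h0 : ∀ i, 0 ≤ f i)
    (hfin : ∀ K : ℝ, {i | f i ≤ K}.Finite) {i : ℕ} (hi : ∀ j, j ≠ i → f i < f j) :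
    ∀ᶠ n in atTop, ∀ j, j ≠ i → cell n (f i) < cell n (f j) := by
  obtain ⟨δ, hδ, hgap⟩ := exists_gap hfin hi
  filter_upwards [(tendsto_one_div_add_atTop_nhds_zero_nat (𝕜 := ℝ)).eventually (gt_mem_nhds hδ)]
    with n hn j hj
  exact cell_lt_of_add_le (h0 i) (by linarith [hgap j hj])

omit [MeasurableSpace Ω] in
lemma eventually_mem_cellEvent_iff {d : ℝ} {ω : Ω} (hfin : ∀ K : ℝ, {i | ‖x i ω‖ ≤ K}.Finite)
    (hex : ∃ i, ∀ j, j ≠ i → ‖x i ω‖ < ‖x j ω‖) :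
    ∀ᶠ n in atTop, ω ∈ ⋃ c, cellEvent d x Θ n c ↔ ω ∈ dominantEvent d x Θ := by
  obtain ⟨i, hi⟩ := hex
  have hfin2 : ∀ K : ℝ, {j | (pairAt d x Θ j ω).2 ≤ K}.Finite := by
    refine fun K => (hfin (K + |d|)).subset fun j hj => ?_
    have hj' : ‖displace d (x j ω) (Θ j ω)‖ ≤ K := hj
    have : ‖x j ω‖ ≤ ‖displace d (x j ω) (Θ j ω)‖ + |d| := norm_le_norm_displace _ _ _
    exact this.trans (add_le_add_left hj' _)
  have hev := eventually_forall_cell_lt (f := fun j => ‖x j ω‖) (fun j => norm_nonneg _) hfin hi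
  by_cases hN : ω ∈ dominantEvent d x Θ
  · obtain ⟨i', hi'⟩ := hN
    have hii : i' = i := by
      by_contra hne
      exact lt_asymm (hi i' hne) (hi' i (Ne.symm hne)).1
    subst hii
    have hev2 := eventually_forall_cell_lt (f := fun j => (pairAt d x Θ j ω).2)
      (fun j => norm_nonneg _) hfin2 (fun j hj => (hi' j hj).2)
    filter_upwards [hev, hev2] with n h1 h2
    refine iff_of_true (Set.mem_iUnion.2 ⟨cellPair n (pairAt d x Θ i' ω),
      mem_cellEvent.2 ⟨⟨i', rfl⟩, fun j hj => ?_⟩⟩) ⟨i', hi'⟩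
    by_contra hne
    have hji : j ≠ i' := fun h => hne (by rw [h])
    rcases hj with hj | hj
    · exact not_le.2 (h1 j hji) hj
    · exact not_le.2 (h2 j hji) hj
  · filter_upwards [hev] with n h1
    refine iff_of_false (fun hmem => hN ?_) hN
    obtain ⟨c, hc⟩ := Set.mem_iUnion.1 hmem
    obtain ⟨⟨k, hk⟩, hall⟩ := mem_cellEvent.1 hc
    have hik : cell n ‖x i ω‖ ≤ c.1 := by
      rw [← hk]
      by_cases hki : k = i
      · rw [hki]; exact le_rfl
      · exact (h1 k hki).le
    have hic := hall i (Or.inl hik)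
    refine ⟨i, fun j hj => ⟨hi j hj, ?_⟩⟩
    by_contra hle
    rw [not_lt] at hle
    have hjc := hall j (Or.inr (by
      rw [← hic]
      exact cell_mono n hle))
    have : cell n ‖x j ω‖ = cell n ‖x i ω‖ := congrArg Prod.fst (hjc.trans hic.symm)
    exact (h1 j hj).ne' this

/-- Probability that the initially closest point is also the finally closest one. -/
theorem IsMobileNetwork.prob_dominantEvent [IsProbabilityMeasure P]
    (hnet : IsMobileNetwork P lam x Θ) (hlam : 0 < lam) (d : ℝ) :
    NullMeasurableSet (dominantEvent d x Θ) P ∧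
    P (dominantEvent d x Θ) = ∫⁻ p, ENNReal.ofReal
      (lam * Real.exp (-lam * (distLaw d).real {q | q.1 ≤ p.1 ∨ q.2 ≤ p.2})) ∂distLaw d := by
  have hm := hnet.measurable_pairAt d
  have hE : ∀ n, MeasurableSet (⋃ c, cellEvent d x Θ n c) := fun n =>
    MeasurableSet.iUnion fun c => measurableSet_cellEvent hm n c
  have hlim : ∀ᵐ ω ∂P, ∀ᶠ n in atTop,
      ω ∈ ⋃ c, cellEvent d x Θ n c ↔ ω ∈ dominantEvent d x Θ := by
    filter_upwards [hnet.ppp.ae_locallyFinite hlam.le, hnet.ppp.ae_exists_closest hlam.le]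
      with ω h1 h2
    exact eventually_mem_cellEvent_iff h1 h2
  have hnull : NullMeasurableSet (dominantEvent d x Θ) P :=
    nullMeasurableSet_of_tendsto_indicator atTop (fun n => (hE n).nullMeasurableSet) hlim
  refine ⟨hnull, ?_⟩
  obtain ⟨N, hN, hNeq⟩ := hnull
  have hT := tendsto_measure_of_ae_tendsto_indicator_of_isFiniteMeasure (μ := P) atTop hN hE (by
    filter_upwards [hlim, hNeq.mem_iff] with ω h1 h2
    exact h1.mono fun n hn => hn.trans h2)
  rw [measure_congr hNeq]
  refine tendsto_nhds_unique hT ?_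
  refine (tendsto_lintegral_cellDensity hlam d).congr fun n => ?_
  rw [lintegral_cellDensity, measure_iUnion (pairwise_disjoint_cellEvent d n)
    (fun c => measurableSet_cellEvent hm n c)]
  exact tsum_congr fun c => (hnet.prob_cellEvent hlam.le d n c).symm

end DominantPoint

section Handover

variable {Ω : Type*} [MeasurableSpace Ω] {P : Measure Ω} {lam : ℝ} {x : ℕ → Ω → Plane}
  {Θ : ℕ → Ω → ℝ}

lemma norm_location_le_iff {h v s : ℝ} {y y' : Plane} {θ θ' : ℝ} :
    ‖location h v y θ s‖ ≤ ‖location h v y' θ' s‖ ↔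
      ‖displace (v * s) y θ‖ ≤ ‖displace (v * s) y' θ'‖ := by
  have hl : ∀ (y : Plane) (θ : ℝ), ‖location h v y θ s‖ ^ 2 =
      ‖displace (v * s) y θ‖ ^ 2 + h ^ 2 := by
    intro y θ
    rw [EuclideanSpace.norm_sq_eq, EuclideanSpace.norm_sq_eq]
    simp [location, displace, Fin.sum_univ_three]
  rw [← sq_le_sq₀ (norm_nonneg _) (norm_nonneg _), hl, hl, add_le_add_iff_right,
    sq_le_sq₀ (norm_nonneg _) (norm_nonneg _)]

lemma sq_norm_displace (d : ℝ) (y : Plane) (θ : ℝ) :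
    ‖displace d y θ‖ ^ 2 =
      ‖y‖ ^ 2 + 2 * d * (y 0 * Real.cos θ + y 1 * Real.sin θ) + d ^ 2 := by
  rw [EuclideanSpace.norm_sq_eq, EuclideanSpace.norm_sq_eq]
  simp [displace]
  linear_combination d ^ 2 * Real.sin_sq_add_cos_sq θ

lemma norm_displace_lt {v s t : ℝ} (hs : 0 ≤ s) (hst : s ≤ t) (ht : 0 < t) {y y' : Plane}
    {θ θ' : ℝ} (h0 : ‖y‖ < ‖y'‖) (h1 : ‖displace (v * t) y θ‖ < ‖displace (v * t) y' θ'‖) :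
    ‖displace (v * s) y θ‖ < ‖displace (v * s) y' θ'‖ := by
  rw [← sq_lt_sq₀ (norm_nonneg _) (norm_nonneg _), sq_norm_displace, sq_norm_displace] at h1 ⊢
  rw [← sq_lt_sq₀ (norm_nonneg _) (norm_nonneg _)] at h0
  set b := y 0 * Real.cos θ + y 1 * Real.sin θ
  set b' := y' 0 * Real.cos θ' + y' 1 * Real.sin θ'
  have key : t * (‖y'‖ ^ 2 + 2 * (v * s) * b' - (‖y‖ ^ 2 + 2 * (v * s) * b)) =
      (t - s) * (‖y'‖ ^ 2 - ‖y‖ ^ 2) +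
        s * (‖y'‖ ^ 2 + 2 * (v * t) * b' - (‖y‖ ^ 2 + 2 * (v * t) * b)) := by ring
  have hpos : 0 < t * (‖y'‖ ^ 2 + 2 * (v * s) * b' - (‖y‖ ^ 2 + 2 * (v * s) * b)) := by
    rw [key]
    rcases hs.eq_or_lt with rfl | hs'
    · rw [zero_mul, add_zero, sub_zero]
      exact mul_pos ht (by linarith)
    · exact add_pos_of_nonneg_of_pos (mul_nonneg (by linarith) (by linarith))
        (mul_pos hs' (by linarith))
  have := pos_of_mul_pos_right hpos ht.le
  linarith

omit [MeasurableSpace Ω] in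
lemma mem_servingSet {h v s : ℝ} {ω : Ω} {i : ℕ} : i ∈ servingSet h v x Θ s ω ↔
    ∀ j, ‖displace (v * s) (x i ω) (Θ i ω)‖ ≤ ‖displace (v * s) (x j ω) (Θ j ω)‖ :=
  forall_congr' fun _ => norm_location_le_iff

omit [MeasurableSpace Ω] in
lemma servingSet_eq_singleton {h v s : ℝ} {ω : Ω} {i : ℕ} (hi : ∀ j, j ≠ i →
    ‖displace (v * s) (x i ω) (Θ i ω)‖ < ‖displace (v * s) (x j ω) (Θ j ω)‖) :
    servingSet h v x Θ s ω = {i} := by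
  ext j
  rw [mem_servingSet, Set.mem_singleton_iff]
  constructor
  · intro hj
    by_contra hne
    exact not_le.2 (hi j hne) (hj i)
  · rintro rfl k
    by_cases hk : k = j
    · rw [hk]
    · exact (hi k hk).le

lemma displace_zero (y : Plane) (θ : ℝ) : displace 0 y θ = y := by
  ext i
  fin_cases i <;> simp [displace]

omit [MeasurableSpace Ω] in
lemma notMem_handover_iff {h v t : ℝ} (ht : 0 < t) {ω : Ω}
    (hex : ∃ i, ∀ j, j ≠ i → ‖x i ω‖ < ‖x j ω‖) :
    ω ∉ handover h v x Θ t ↔ ω ∈ dominantEvent (v * t) x Θ := by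
  constructor
  · intro hno
    obtain ⟨i, hi⟩ := hex
    have h0 : servingSet h v x Θ 0 ω = {i} := servingSet_eq_singleton fun j hj => by
      simpa [displace_zero] using hi j hj
    have h1 : servingSet h v x Θ t ω = {i} := by
      by_contra hne
      exact hno ⟨0, le_rfl, ht, fun h => hne (by rw [← h, h0])⟩
    refine ⟨i, fun j hj => ⟨hi j hj, ?_⟩⟩
    have hjn : j ∉ servingSet h v x Θ t ω := by rw [h1]; exact hj
    have hin : i ∈ servingSet h v x Θ t ω := by rw [h1]; rfl
    rw [mem_servingSet] at hjn hin
    obtain ⟨k, hk⟩ := not_forall.1 hjn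
    exact (hin k).trans_lt (not_le.1 hk)
  · rintro ⟨i, hi⟩ ⟨s, hs, hst, hne⟩
    have key : ∀ s, 0 ≤ s → s ≤ t → servingSet h v x Θ s ω = {i} := fun s hs hst =>
      servingSet_eq_singleton fun j hj => norm_displace_lt hs hst ht (hi j hj).1 (hi j hj).2
    exact hne (by rw [key s hs hst.le, key t ht.le le_rfl])

/-- The handover probability, as an integral over the distances of the serving station. -/
theorem IsMobileNetwork.prob_handover [IsProbabilityMeasure P]
    (hnet : IsMobileNetwork P lam x Θ) (hlam : 0 < lam) (h v : ℝ) {t : ℝ} (ht : 0 < t) :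
    NullMeasurableSet (handover h v x Θ t) P ∧
    P.real (handover h v x Θ t) = 1 - (∫⁻ p, ENNReal.ofReal
      (lam * Real.exp (-lam * (distLaw (v * t)).real {q | q.1 ≤ p.1 ∨ q.2 ≤ p.2}))
        ∂distLaw (v * t)).toReal := by
  obtain ⟨hN, hP⟩ := hnet.prob_dominantEvent hlam (v * t)
  have heq : handover h v x Θ t =ᵐ[P] ((dominantEvent (v * t) x Θ)ᶜ : Set Ω) := by
    filter_upwards [hnet.ppp.ae_exists_closest hlam.le] with ω hω
    refine propext (?_ : ω ∈ handover h v x Θ t ↔ ω ∉ dominantEvent (v * t) x Θ)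
    rw [← notMem_handover_iff (h := h) ht hω, not_not]
  refine ⟨hN.compl.congr heq.symm, ?_⟩
  rw [measureReal_congr heq, probReal_compl_eq_one_sub₀ hN, measureReal_def, hP]

end Handover

section ServingDensity

lemma finalDist_nonneg (v t u θ : ℝ) : 0 ≤ finalDist v t u θ := Real.sqrt_nonneg _

lemma finalDist_eq (v t u θ : ℝ) :
    finalDist v t u θ = Real.sqrt (u ^ 2 + (v * t) ^ 2 - 2 * u * (v * t) * Real.cos θ) := by
  unfold finalDist
  congr 1
  ring

lemma finalDist_periodic (v t u : ℝ) : Function.Periodic (finalDist v t u) (2 * Real.pi) :=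
  fun θ => by simp [finalDist]

/-- Contribution to the probability of no handover, up to the factor `1 / (2 π)`, of an initial
serving distance `u`. -/
noncomputable def noHandoverDensity (lam v t u : ℝ) : ℝ :=
  ∫ θ in (0 : ℝ)..(2 * Real.pi), 2 * Real.pi * lam * u *
    Real.exp (-lam * (Real.pi * u ^ 2 + discDiffArea (v * t) u (finalDist v t u θ)))

/-- Weight of the polar coordinates of the serving station in the frame of its displacement. -/
noncomputable def polarWeight (lam d ρ φ : ℝ) : ℝ :=
  ρ * (lam * Real.exp (-lam * (distLaw d).real
    {q | q.1 ≤ ρ ∨ q.2 ≤ Real.sqrt (ρ ^ 2 + d ^ 2 - 2 * ρ * d * Real.cos φ)}))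

lemma measurable_distLaw_union (d : ℝ) :
    Measurable fun p : ℝ × ℝ => (distLaw d).real {q | q.1 ≤ p.1 ∨ q.2 ≤ p.2} := by
  have hS : MeasurableSet {z : (ℝ × ℝ) × (ℝ × ℝ) | z.2.1 ≤ z.1.1 ∨ z.2.2 ≤ z.1.2} :=
    (measurableSet_le (measurable_fst.comp measurable_snd) (measurable_fst.comp measurable_fst)).union
      (measurableSet_le (measurable_snd.comp measurable_snd) (measurable_snd.comp measurable_fst))
  exact (measurable_measure_prodMk_left (ν := distLaw d) hS).ennreal_toReal

lemma measurable_polarWeight (lam d : ℝ) : Measurable (Function.uncurry (polarWeight lam d)) := by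
  have h : Measurable fun p : ℝ × ℝ =>
      (p.1, Real.sqrt (p.1 ^ 2 + d ^ 2 - 2 * p.1 * d * Real.cos p.2)) := by fun_prop
  have h2 := (measurable_distLaw_union d).comp h
  exact measurable_fst.mul ((Real.measurable_exp.comp (h2.const_mul (-lam))).const_mul lam)

lemma polarWeight_eq {lam v t ρ φ : ℝ} (hd : 0 < v * t) (hρ : 0 ≤ ρ) :
    polarWeight lam (v * t) ρ φ = 1 / (2 * Real.pi) * (2 * Real.pi * lam * ρ *
      Real.exp (-lam * (Real.pi * ρ ^ 2 + discDiffArea (v * t) ρ (finalDist v t ρ φ)))) := by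
  rw [polarWeight, ← finalDist_eq, distLaw_real_union hd hρ (finalDist_nonneg _ _ _ _)]
  field_simp [Real.pi_pos.ne']

lemma polarWeight_nonneg {lam d ρ φ : ℝ} (hlam : 0 ≤ lam) (hρ : 0 ≤ ρ) :
    0 ≤ polarWeight lam d ρ φ :=
  mul_nonneg hρ (mul_nonneg hlam (Real.exp_pos _).le)

lemma polarWeight_le {lam d ρ φ : ℝ} (hlam : 0 ≤ lam) (hρ : 0 ≤ ρ) :
    polarWeight lam d ρ φ ≤ lam * (ρ * Real.exp (-(lam * Real.pi) * ρ ^ 2)) := by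
  have hm := measureReal_mono (μ := distLaw d) (s₁ := {q | q.1 ≤ ρ})
    (s₂ := {q | q.1 ≤ ρ ∨ q.2 ≤ Real.sqrt (ρ ^ 2 + d ^ 2 - 2 * ρ * d * Real.cos φ)})
    (fun q hq => Or.inl hq) (distLaw_union_ne_top d _ _)
  rw [real_distLaw_fst_le d hρ] at hm
  rw [polarWeight, mul_left_comm]
  refine mul_le_mul_of_nonneg_left (mul_le_mul_of_nonneg_left ?_ hρ) hlam
  rw [Real.exp_le_exp]
  nlinarith [mul_le_mul_of_nonneg_left hm hlam]

lemma integral_polarWeight {lam v t ρ : ℝ} (hd : 0 < v * t) (hρ : 0 ≤ ρ) :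
    ∫ φ in Set.Ioo (-Real.pi) Real.pi, polarWeight lam (v * t) ρ φ =
      1 / (2 * Real.pi) * noHandoverDensity lam v t ρ := by
  have hper : Function.Periodic (fun θ => 2 * Real.pi * lam * ρ *
      Real.exp (-lam * (Real.pi * ρ ^ 2 + discDiffArea (v * t) ρ (finalDist v t ρ θ))))
      (2 * Real.pi) := fun θ => by simp only [finalDist_periodic v t ρ θ]
  have h := hper.intervalIntegral_add_eq (-Real.pi) 0
  rw [show -Real.pi + 2 * Real.pi = Real.pi by ring, zero_add] at h
  simp_rw [polarWeight_eq hd hρ]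
  rw [integral_const_mul, noHandoverDensity, ← h,
    intervalIntegral.integral_of_le (by linarith [Real.pi_pos]), integral_Ioc_eq_integral_Ioo]

lemma integrable_polarWeight {lam d ρ : ℝ} (hlam : 0 ≤ lam) (hρ : 0 ≤ ρ) :
    IntegrableOn (polarWeight lam d ρ) (Set.Ioo (-Real.pi) Real.pi) := by
  refine Measure.integrableOn_of_bounded (by simp)
    ((measurable_polarWeight lam d).comp measurable_prodMk_left).aestronglyMeasurable
    (M := lam * (ρ * Real.exp (-(lam * Real.pi) * ρ ^ 2))) (.of_forall fun φ => ?_)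
  rw [Real.norm_of_nonneg (polarWeight_nonneg hlam hρ)]
  exact polarWeight_le hlam hρ

lemma integrableOn_integral_polarWeight {lam : ℝ} (hlam : 0 < lam) (d : ℝ) :
    IntegrableOn (fun ρ => ∫ φ in Set.Ioo (-Real.pi) Real.pi, polarWeight lam d ρ φ)
      (Set.Ioi 0) := by
  have hb : Integrable fun ρ : ℝ =>
      2 * Real.pi * lam * (ρ * Real.exp (-(lam * Real.pi) * ρ ^ 2)) :=
    (integrable_mul_exp_neg_mul_sq (mul_pos hlam Real.pi_pos)).const_mul _
  refine hb.integrableOn.mono' ?_ ?_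
  · exact ((measurable_polarWeight lam d).stronglyMeasurable.integral_prod_right
      (ν := volume.restrict (Set.Ioo (-Real.pi) Real.pi))).aestronglyMeasurable
  · refine (ae_restrict_iff' measurableSet_Ioi).2 (.of_forall fun ρ (hρ : 0 < ρ) => ?_)
    rw [Real.norm_of_nonneg (integral_nonneg fun φ => polarWeight_nonneg hlam.le hρ.le)]
    refine (integral_mono_of_nonneg (.of_forall fun φ => polarWeight_nonneg hlam.le hρ.le)
      (integrable_const (lam * (ρ * Real.exp (-(lam * Real.pi) * ρ ^ 2))))
      (.of_forall fun φ => polarWeight_le hlam.le hρ.le)).trans (le_of_eq ?_)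
    rw [integral_const, measureReal_restrict_apply_univ, Real.volume_real_Ioo_of_le
      (by linarith [Real.pi_pos]), smul_eq_mul]
    ring

lemma integrableOn_noHandoverDensity {lam v t : ℝ} (hlam : 0 < lam) (hd : 0 < v * t) :
    IntegrableOn (noHandoverDensity lam v t) (Set.Ioi 0) := by
  refine IntegrableOn.congr_fun ((integrableOn_integral_polarWeight hlam (v * t)).const_mul
    (2 * Real.pi)) (fun ρ (hρ : 0 < ρ) => ?_) measurableSet_Ioi
  rw [integral_polarWeight hd hρ.le]
  field_simp [Real.pi_pos.ne']

/-- The integral over the distances of the serving station, in polar coordinates. -/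
lemma toReal_lintegral_distLaw {lam v t : ℝ} (hlam : 0 < lam) (hd : 0 < v * t) :
    (∫⁻ p, ENNReal.ofReal
      (lam * Real.exp (-lam * (distLaw (v * t)).real {q | q.1 ≤ p.1 ∨ q.2 ≤ p.2}))
        ∂distLaw (v * t)).toReal =
      1 / (2 * Real.pi) * ∫ u in Set.Ioi 0, noHandoverDensity lam v t u := by
  have hm : Measurable fun p : ℝ × ℝ => ENNReal.ofReal
      (lam * Real.exp (-lam * (distLaw (v * t)).real {q | q.1 ≤ p.1 ∨ q.2 ≤ p.2})) :=
    ((Real.measurable_exp.comp ((measurable_distLaw_union (v * t)).const_mul (-lam))).const_mul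
      lam).ennreal_ofReal
  rw [lintegral_distLaw _ hm, ← integral_const_mul,
    ← setIntegral_congr_fun measurableSet_Ioi
      (fun ρ (hρ : 0 < ρ) => integral_polarWeight (lam := lam) hd hρ.le),
    integral_eq_lintegral_of_nonneg_ae]
  · congr 1
    refine setLIntegral_congr_fun measurableSet_Ioi fun ρ (hρ : 0 < ρ) => ?_
    rw [ofReal_integral_eq_lintegral_ofReal (integrable_polarWeight hlam.le hρ.le)
      (.of_forall fun φ => polarWeight_nonneg hlam.le hρ.le)]
    refine lintegral_congr fun φ => ?_
    rw [polarWeight, ENNReal.ofReal_mul hρ.le]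
  · exact (ae_restrict_iff' measurableSet_Ioi).2 (.of_forall fun ρ (hρ : 0 < ρ) =>
      integral_nonneg fun φ => polarWeight_nonneg hlam.le hρ.le)
  · exact (integrableOn_integral_polarWeight hlam (v * t)).aestronglyMeasurable

end ServingDensity

section Formulas

lemma discDiffArea_eq_of_lt {d u : ℝ} (hd : 0 < d) (hu : d < u) {r : ℝ} :
    discDiffArea d u r = ∫ ρ in |d - u|..r,
      2 * ρ * Real.arccos ((u ^ 2 - ρ ^ 2 - d ^ 2) / (2 * ρ * d)) := by
  rw [discDiffArea, ← intervalIntegral.integral_add_adjacent_intervals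
    (intervalIntegrable_discDiff d u 0 |d - u|) (intervalIntegrable_discDiff d u _ _),
    add_eq_right, intervalIntegral.integral_of_le (abs_nonneg _)]
  refine setIntegral_eq_zero_of_forall_eq_zero fun ρ hρ => ?_
  have h2 : ρ ≤ u - d := by
    have := hρ.2
    rwa [abs_of_neg (by linarith), neg_sub] at this
  have hpos : 0 < 2 * ρ * d := by have := hρ.1; positivity
  rw [Real.arccos_of_one_le, mul_zero]
  rw [le_div_iff₀ hpos]
  nlinarith [hρ.1]

lemma discDiffArea_eq_of_gt {d u : ℝ} (hu0 : 0 ≤ u) (hu : u < d) {r : ℝ} :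
    discDiffArea d u r = Real.pi * (d - u) ^ 2 + ∫ ρ in |d - u|..r,
      2 * ρ * Real.arccos ((u ^ 2 - ρ ^ 2 - d ^ 2) / (2 * ρ * d)) := by
  have habs : |d - u| = d - u := abs_of_pos (by linarith)
  rw [discDiffArea, ← intervalIntegral.integral_add_adjacent_intervals
    (intervalIntegrable_discDiff d u 0 |d - u|) (intervalIntegrable_discDiff d u _ _),
    add_left_inj, habs, intervalIntegral.integral_of_le (by linarith)]
  have : ∀ ρ ∈ Set.Ioc 0 (d - u),
      2 * ρ * Real.arccos ((u ^ 2 - ρ ^ 2 - d ^ 2) / (2 * ρ * d)) = 2 * Real.pi * ρ := by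
    intro ρ hρ
    have hpos : 0 < 2 * ρ * d := by have := hρ.1; have : 0 < d := by linarith
                                    positivity
    rw [Real.arccos_of_le_neg_one]
    · ring
    · rw [div_le_iff₀ hpos]
      nlinarith [hρ.1, hρ.2]
  rw [setIntegral_congr_fun measurableSet_Ioc this, ← intervalIntegral.integral_of_le (by linarith),
    intervalIntegral.integral_const_mul, integral_id]
  ring

lemma Q_eq (v t u θ : ℝ) : Q v t u θ = ∫ ρ in |v * t - u|..finalDist v t u θ,
    2 * ρ * Real.arccos ((u ^ 2 - ρ ^ 2 - (v * t) ^ 2) / (2 * ρ * (v * t))) := by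
  unfold Q
  congr 1
  funext ρ
  rw [mul_pow]
  field_simp [Real.pi_pos.ne']

theorem ssmFormula_eq {lam v t : ℝ} (hlam : 0 < lam) (hd : 0 < v * t) :
    ssmFormula lam v t =
      1 - 1 / (2 * Real.pi) * ∫ u in Set.Ioi 0, noHandoverDensity lam v t u := by
  have hint := integrableOn_noHandoverDensity hlam hd
  rw [← intervalIntegral.integral_interval_add_Ioi hint
    (hint.mono_set (Set.Ioi_subset_Ioi hd.le)), ssmFormula]
  have h1 : ∫ u in Set.Ioi (v * t), ∫ θ in (0 : ℝ)..(2 * Real.pi),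
        2 * Real.pi * lam * u * Real.exp (-lam * (Real.pi * u ^ 2 + Q v t u θ)) =
      ∫ u in Set.Ioi (v * t), noHandoverDensity lam v t u := by
    refine setIntegral_congr_fun measurableSet_Ioi fun u (hu : v * t < u) => ?_
    simp only [noHandoverDensity, Q_eq, discDiffArea_eq_of_lt hd hu]
  have h2 : ∫ u in (0 : ℝ)..(v * t), ∫ θ in (0 : ℝ)..(2 * Real.pi), 2 * Real.pi * lam * u *
        Real.exp (-lam * (Real.pi * u ^ 2 + Real.pi * (v * t - u) ^ 2 + Q v t u θ)) =
      ∫ u in (0 : ℝ)..(v * t), noHandoverDensity lam v t u := by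
    rw [intervalIntegral.integral_of_le hd.le, intervalIntegral.integral_of_le hd.le,
      integral_Ioc_eq_integral_Ioo, integral_Ioc_eq_integral_Ioo]
    refine setIntegral_congr_fun measurableSet_Ioo fun u hu => ?_
    simp only [noHandoverDensity, Q_eq, discDiffArea_eq_of_gt hu.1.le hu.2, add_assoc]
  rw [h1, h2]
  ring

lemma ssmFormula_zero {lam : ℝ} (hlam : 0 < lam) (v : ℝ) : ssmFormula lam v 0 = 0 := by
  have hb : 0 < lam * Real.pi := mul_pos hlam Real.pi_pos
  have hQ : ∀ u ∈ Set.Ioi (0 : ℝ), (∫ θ in (0 : ℝ)..(2 * Real.pi),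
      2 * Real.pi * lam * u * Real.exp (-lam * (Real.pi * u ^ 2 + Q v 0 u θ))) =
      2 * Real.pi * (2 * (lam * Real.pi) * u * Real.exp (-(lam * Real.pi) * u ^ 2)) := by
    intro u (hu : 0 < u)
    have : ∀ θ, Q v 0 u θ = 0 := by
      intro θ
      simp [Q, finalDist, Real.sqrt_sq hu.le, abs_of_pos hu]
    simp only [this, intervalIntegral.integral_const, smul_eq_mul]
    ring_nf
  have hder : ∀ u ∈ Set.Ioi (0 : ℝ), HasDerivAt (fun u => -Real.exp (-(lam * Real.pi) * u ^ 2))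
      (2 * (lam * Real.pi) * u * Real.exp (-(lam * Real.pi) * u ^ 2)) u := by
    intro u _
    have := (((hasDerivAt_pow 2 u).const_mul (-(lam * Real.pi))).exp).neg
    refine this.congr_deriv ?_
    push_cast
    ring
  have hlim : Tendsto (fun u : ℝ => -Real.exp (-(lam * Real.pi) * u ^ 2)) atTop (𝓝 0) := by
    rw [← neg_zero]
    refine (Real.tendsto_exp_atBot.comp ?_).neg
    exact (tendsto_pow_atTop two_ne_zero).const_mul_atTop_of_neg (neg_neg_of_pos hb)
  have hint : IntegrableOn (fun u : ℝ =>
      2 * (lam * Real.pi) * u * Real.exp (-(lam * Real.pi) * u ^ 2)) (Set.Ioi 0) := by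
    refine (((integrable_mul_exp_neg_mul_sq hb).const_mul (2 * (lam * Real.pi))).congr
      (.of_forall fun u => ?_)).integrableOn
    ring
  have hI := integral_Ioi_of_hasDerivAt_of_tendsto (by fun_prop) hder hint hlim
  rw [ssmFormula, mul_zero, setIntegral_congr_fun measurableSet_Ioi hQ, integral_const_mul, hI]
  field_simp [Real.pi_pos.ne']
  simp

lemma nonServingDensity_dirac {lam v t u ρ : ℝ} (hv : 0 < v) (ht : 0 < t) (hu : 0 ≤ u)
    (hρ : 0 < ρ) :
    nonServingDensity lam (Measure.dirac v) t ρ u =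
      lam * (1 / Real.pi * Real.arccos ((u ^ 2 - ρ ^ 2 - (v * t) ^ 2) / (2 * ρ * (v * t)))) := by
  classical
  have hd : 0 < v * t := mul_pos hv ht
  set d := v * t with hddef
  have hpos : 0 < 2 * ρ * d := by positivity
  have hpi := Real.pi_pos.ne'
  have hreal : (Measure.dirac v).real (Set.Iic ((u - ρ) / t)) = if d ≤ u - ρ then 1 else 0 := by
    rw [measureReal_def, Measure.dirac_apply' _ measurableSet_Iic]
    simp only [Set.indicator_apply, Set.mem_Iic, le_div_iff₀ ht, ← hddef]
    split_ifs <;> simp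
  have harg : (v ^ 2 * t ^ 2 + ρ ^ 2 - u ^ 2) / (2 * v * t * ρ) =
      -((u ^ 2 - ρ ^ 2 - d ^ 2) / (2 * ρ * d)) := by
    rw [← neg_div, hddef]
    congr 1 <;> ring
  unfold nonServingDensity
  rw [setIntegral_dirac, hreal, harg, Real.arccos_neg]
  simp only [Set.mem_Ioc, div_lt_iff₀ ht, le_div_iff₀ ht, ← hddef]
  congr 1
  by_cases h1 : d ≤ u - ρ
  · have h2 : ¬ (|u - ρ| < d ∧ d ≤ u + ρ) := fun h => by
      linarith [h.1, le_abs_self (u - ρ)]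
    rw [if_pos h1, if_neg h2, Real.arccos_of_one_le]
    · simp
    · rw [le_div_iff₀ hpos]; nlinarith
  · rw [if_neg h1]
    rw [not_le] at h1
    by_cases h2 : |u - ρ| < d ∧ d ≤ u + ρ
    · rw [if_pos h2]
      field_simp
      ring
    · rw [if_neg h2, Real.arccos_of_le_neg_one]
      · field_simp
        ring
      · rw [div_le_iff₀ hpos]
        rcases not_and_or.1 h2 with h | h
        · rw [not_lt] at h
          rcases le_abs.1 h with h | h
          · linarith
          · nlinarith
        · rw [not_le] at h
          nlinarith

theorem dsmLowerBound_dirac {lam v t : ℝ} (hv : 0 < v) (ht : 0 < t) :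
    dsmLowerBound lam (Measure.dirac v) t =
      1 - 1 / (2 * Real.pi) * ∫ u in Set.Ioi 0, noHandoverDensity lam v t u := by
  rw [dsmLowerBound, integral_dirac]
  congr 2
  refine setIntegral_congr_fun measurableSet_Ioi fun u (hu : 0 < u) => ?_
  refine intervalIntegral.integral_congr fun θ _ => ?_
  have h : ∫ ρ in (0 : ℝ)..finalDist v t u θ,
      2 * Real.pi * ρ * nonServingDensity lam (Measure.dirac v) t ρ u =
      lam * discDiffArea (v * t) u (finalDist v t u θ) := by
    rw [discDiffArea, ← intervalIntegral.integral_const_mul,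
      intervalIntegral.integral_of_le (finalDist_nonneg _ _ _ _),
      intervalIntegral.integral_of_le (finalDist_nonneg _ _ _ _)]
    refine setIntegral_congr_fun measurableSet_Ioc fun ρ hρ => ?_
    rw [nonServingDensity_dirac hv ht hu.le hρ.1]
    field_simp [Real.pi_pos.ne']
  rw [h, mul_assoc, ← Real.exp_add]
  ring_nf

/-- Half of the normalised area of a disc cut by a chord, as a function of the cosine of the half
angle. -/
noncomputable def chordArea (c : ℝ) : ℝ := Real.pi - Real.arccos c + c * Real.sqrt (1 - c ^ 2)

lemma chordArea_eq {c : ℝ} (h1 : -1 ≤ c) (h2 : c ≤ 1) : Real.pi - Real.arccos c +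
    1 / 2 * Real.sin (2 * Real.arccos c) = chordArea c := by
  rw [chordArea, Real.sin_two_mul, Real.sin_arccos, Real.cos_arccos h1 h2]
  ring

lemma continuous_chordArea : Continuous chordArea := by
  unfold chordArea
  have := Real.continuous_arccos
  fun_prop

lemma chordArea_one : chordArea 1 = Real.pi := by simp [chordArea]

lemma chordArea_neg_one : chordArea (-1) = 0 := by simp [chordArea]

lemma hasDerivAt_chordArea {c : ℝ} (h1 : -1 < c) (h2 : c < 1) :
    HasDerivAt chordArea (2 * Real.sqrt (1 - c ^ 2)) c := by
  have hpos : 0 < 1 - c ^ 2 := by nlinarith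
  have hs : HasDerivAt (fun c : ℝ => 1 - c ^ 2) (-(2 * c)) c := by
    simpa using ((hasDerivAt_pow 2 c).const_sub 1)
  have h := ((Real.hasDerivAt_arccos h1.ne' h2.ne).const_sub Real.pi).add
    ((hasDerivAt_id c).mul (hs.sqrt hpos.ne'))
  refine (h.congr_deriv ?_ : HasDerivAt chordArea _ c)
  have hsq := Real.sq_sqrt hpos.le
  have hne : Real.sqrt (1 - c ^ 2) ≠ 0 := (Real.sqrt_pos.2 hpos).ne'
  field_simp
  simp only [id]
  linear_combination -hsq

/-- Area of the union of the discs of radii `u` and `ρ` around two points at distance `d`, when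
the boundaries meet. -/
noncomputable def unionArea (d u ρ : ℝ) : ℝ :=
  u ^ 2 * chordArea ((d ^ 2 + u ^ 2 - ρ ^ 2) / (2 * d * u)) +
    ρ ^ 2 * chordArea ((d ^ 2 + ρ ^ 2 - u ^ 2) / (2 * d * ρ))

lemma hasDerivAt_unionArea {d u ρ : ℝ} (hd : 0 < d) (hu : 0 < u) (h1 : |d - u| < ρ)
    (h2 : ρ < d + u) :
    HasDerivAt (unionArea d u)
      (2 * ρ * Real.arccos ((u ^ 2 - ρ ^ 2 - d ^ 2) / (2 * ρ * d))) ρ := by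
  have hρ : 0 < ρ := (abs_nonneg _).trans_lt h1
  obtain ⟨h3, h4⟩ := abs_lt.1 h1
  set c₁ := (d ^ 2 + u ^ 2 - ρ ^ 2) / (2 * d * u) with hc₁
  set c₂ := (d ^ 2 + ρ ^ 2 - u ^ 2) / (2 * d * ρ) with hc₂
  have hc₁l : -1 < c₁ := by rw [hc₁, lt_div_iff₀ (by positivity)]; nlinarith
  have hc₁u : c₁ < 1 := by rw [hc₁, div_lt_iff₀ (by positivity)]; nlinarith
  have hc₂l : -1 < c₂ := by rw [hc₂, lt_div_iff₀ (by positivity)]; nlinarith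
  have hc₂u : c₂ < 1 := by rw [hc₂, div_lt_iff₀ (by positivity)]; nlinarith
  have hd1 : HasDerivAt (fun ρ => (d ^ 2 + u ^ 2 - ρ ^ 2) / (2 * d * u))
      (-(2 * ρ) / (2 * d * u)) ρ := by
    simpa using (((hasDerivAt_pow 2 ρ).const_sub (d ^ 2 + u ^ 2)).div_const (2 * d * u))
  have hd2 : HasDerivAt (fun ρ => (d ^ 2 + ρ ^ 2 - u ^ 2) / (2 * d * ρ))
      ((2 * ρ * (2 * d * ρ) - (d ^ 2 + ρ ^ 2 - u ^ 2) * (2 * d)) / (2 * d * ρ) ^ 2) ρ := by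
    have hnum : HasDerivAt (fun ρ : ℝ => d ^ 2 + ρ ^ 2 - u ^ 2) (2 * ρ) ρ := by
      simpa using (((hasDerivAt_pow 2 ρ).const_add (d ^ 2)).sub_const (u ^ 2))
    have hden : HasDerivAt (fun ρ : ℝ => 2 * d * ρ) (2 * d) ρ := by
      simpa using (hasDerivAt_id ρ).const_mul (2 * d)
    exact hnum.div hden (by positivity)
  have hK1 := ((hasDerivAt_chordArea hc₁l hc₁u).comp ρ hd1).const_mul (u ^ 2)
  have hK2 := (hasDerivAt_pow 2 ρ).mul ((hasDerivAt_chordArea hc₂l hc₂u).comp ρ hd2)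
  have h := hK1.add hK2
  have hH : u * Real.sqrt (1 - c₁ ^ 2) = ρ * Real.sqrt (1 - c₂ ^ 2) := by
    rw [← sq_eq_sq₀ (by positivity) (by positivity), mul_pow, mul_pow,
      Real.sq_sqrt (by nlinarith), Real.sq_sqrt (by nlinarith), hc₁, hc₂]
    field_simp
    ring
  refine (h.congr_deriv ?_ : HasDerivAt (unionArea d u) _ ρ)
  have harg : (u ^ 2 - ρ ^ 2 - d ^ 2) / (2 * ρ * d) = -c₂ := by
    rw [hc₂, ← neg_div]
    congr 1 <;> ring
  rw [harg, Real.arccos_neg]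
  simp only [Function.comp_apply, ← hc₂, chordArea]
  have e1 : u ^ 2 * (2 * Real.sqrt (1 - c₁ ^ 2) * (-(2 * ρ) / (2 * d * u))) =
      -(2 * ρ / d) * (u * Real.sqrt (1 - c₁ ^ 2)) := by
    field_simp
  rw [e1, hH]
  have e2 : (2 * ρ * (2 * d * ρ) - (d ^ 2 + ρ ^ 2 - u ^ 2) * (2 * d)) / (2 * d * ρ) ^ 2 =
      1 / d - c₂ / ρ := by
    rw [hc₂]
    field_simp
  rw [e2]
  push_cast
  field_simp
  ring

lemma unionArea_abs_sub {d u : ℝ} (hd : 0 < d) (hu : 0 < u) (hne : u ≠ d) :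
    unionArea d u |d - u| = Real.pi * u ^ 2 + if u < d then Real.pi * (d - u) ^ 2 else 0 := by
  have h1 : (d ^ 2 + u ^ 2 - |d - u| ^ 2) / (2 * d * u) = 1 := by
    rw [sq_abs, div_eq_one_iff_eq (by positivity)]
    ring
  rw [unionArea, h1, chordArea_one, sq_abs]
  rcases lt_or_gt_of_ne hne with h | h
  · have hpos : 0 < d - u := sub_pos.2 h
    have h2 : (d ^ 2 + (d - u) ^ 2 - u ^ 2) / (2 * d * |d - u|) = 1 := by
      rw [abs_of_pos hpos, div_eq_one_iff_eq (by positivity)]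
      ring
    rw [h2, chordArea_one, if_pos h]
    ring
  · have hpos : 0 < u - d := sub_pos.2 h
    have h2 : (d ^ 2 + (d - u) ^ 2 - u ^ 2) / (2 * d * |d - u|) = -1 := by
      rw [abs_sub_comm, abs_of_pos hpos, div_eq_iff (by positivity)]
      ring
    rw [h2, chordArea_neg_one, if_neg h.not_gt]
    ring

lemma unionArea_eq {d u r : ℝ} (hd : 0 < d) (hu : 0 < u) (hne : u ≠ d) (h1 : |d - u| ≤ r)
    (h2 : r ≤ d + u) : unionArea d u r = Real.pi * u ^ 2 + discDiffArea d u r := by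
  have hpos : 0 < |d - u| := abs_pos.2 (sub_ne_zero.2 hne.symm)
  have hcont : ContinuousOn (unionArea d u) (Set.Icc |d - u| r) := by
    unfold unionArea
    have hc := continuous_chordArea
    refine ContinuousOn.add (by fun_prop) (ContinuousOn.mul (by fun_prop)
      (hc.comp_continuousOn (ContinuousOn.div (by fun_prop) (by fun_prop) fun ρ hρ => ?_)))
    have := hpos.trans_le hρ.1
    positivity
  have hftc := intervalIntegral.integral_eq_sub_of_hasDerivAt_of_le h1 hcont
    (fun ρ hρ => hasDerivAt_unionArea hd hu hρ.1 (hρ.2.trans_le h2))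
    (intervalIntegrable_discDiff d u _ _)
  rw [unionArea_abs_sub hd hu hne] at hftc
  rcases lt_or_gt_of_ne hne with h | h
  · rw [discDiffArea_eq_of_gt hu.le h, hftc, if_pos h]
    ring
  · rw [discDiffArea_eq_of_lt hd h, hftc, if_neg h.not_gt]
    ring

lemma abs_sub_le_finalDist {v t u : ℝ} (hd : 0 < v * t) (hu : 0 < u) (θ : ℝ) :
    |v * t - u| ≤ finalDist v t u θ := by
  rw [finalDist_eq]
  refine Real.le_sqrt_of_sq_le ?_
  rw [sq_abs]
  nlinarith [mul_nonneg (mul_pos hu hd).le (sub_nonneg.2 (Real.cos_le_one θ))]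

lemma finalDist_le_add {v t u : ℝ} (hd : 0 < v * t) (hu : 0 < u) (θ : ℝ) :
    finalDist v t u θ ≤ v * t + u := by
  rw [finalDist_eq]
  refine Real.sqrt_le_iff.2 ⟨by positivity, ?_⟩
  nlinarith [mul_nonneg (mul_pos hu hd).le (neg_le_iff_add_nonneg.1 (Real.neg_one_le_cos θ))]

theorem terrestrialFormula_eq {lam v t : ℝ} (hd : 0 < v * t) :
    terrestrialFormula lam v t =
      1 - 1 / (2 * Real.pi) * ∫ u in Set.Ioi 0, noHandoverDensity lam v t u := by
  rw [terrestrialFormula]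
  congr 2
  refine setIntegral_congr_ae measurableSet_Ioi ?_
  have hne : ∀ᵐ u : ℝ, u ≠ v * t := by simp [ae_iff]
  filter_upwards [hne] with u hne (hu : 0 < u)
  refine intervalIntegral.integral_congr fun θ _ => ?_
  have h1 := abs_sub_le_finalDist hd hu θ
  have h2 := finalDist_le_add hd hu θ
  have hR : 0 < finalDist v t u θ := (abs_pos.2 (sub_ne_zero.2 hne.symm)).trans_le h1
  dsimp only
  rw [← unionArea_eq hd hu hne h1 h2, unionArea]
  set R := finalDist v t u θ
  obtain ⟨h3, h4⟩ := abs_le.1 h1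
  have e1 : (v ^ 2 * t ^ 2 + u ^ 2 - R ^ 2) / (2 * v * t * u) =
      ((v * t) ^ 2 + u ^ 2 - R ^ 2) / (2 * (v * t) * u) := by ring_nf
  have e2 : (v ^ 2 * t ^ 2 + R ^ 2 - u ^ 2) / (2 * v * t * R) =
      ((v * t) ^ 2 + R ^ 2 - u ^ 2) / (2 * (v * t) * R) := by ring_nf
  rw [e1, e2, chordArea_eq, chordArea_eq]
  · rw [le_div_iff₀ (by positivity)]; nlinarith
  · rw [div_le_one (by positivity)]; nlinarith
  · rw [le_div_iff₀ (by positivity)]; nlinarith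
  · rw [div_le_one (by positivity)]; nlinarith

end Formulas

end DroneHandover

open DroneHandover in
theorem corollary1 {Ω : Type*} [MeasurableSpace Ω] (P : Measure Ω) [IsProbabilityMeasure P]
    (lam v h : ℝ) (hlam : 0 < lam) (hv : 0 < v)
    (x : ℕ → Ω → Plane) (Θ : ℕ → Ω → ℝ) (hnet : IsMobileNetwork P lam x Θ)
    (t : ℝ) (ht : 0 ≤ t) :
    NullMeasurableSet (handover h v x Θ t) P ∧
    P.real (handover h v x Θ t) = ssmFormula lam v t ∧
    (0 < t → P.real (handover h v x Θ t) = dsmLowerBound lam (Measure.dirac v) t) ∧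
    (0 < t → ssmFormula lam v t = terrestrialFormula lam v t) := by
  rcases ht.eq_or_lt with rfl | ht
  · have hempty : handover h v x Θ 0 = ∅ :=
      Set.eq_empty_of_forall_notMem fun ω ⟨s, hs, hs', _⟩ => not_lt.2 hs hs'
    rw [hempty, ssmFormula_zero hlam]
    simp
  · have hd : 0 < v * t := mul_pos hv ht
    obtain ⟨hnull, hprob⟩ := hnet.prob_handover hlam h v ht
    rw [toReal_lintegral_distLaw hlam hd] at hprob
    rw [hprob, ssmFormula_eq hlam hd, dsmLowerBound_dirac hv ht, terrestrialFormula_eq hd]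
    exact ⟨hnull, rfl, fun _ => rfl, fun _ => rfl⟩
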